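/- **Setting.** Let $p,d\ge 0$ and $J,n\ge 1$ be integers, let $\Theta\subset\mathbb R^p$ be compact and convex, and let $\Xi=\mathbb R^d\times\{1,\dots,J\}$ (the second factor being discrete). Let $\xi_1,\dots,\xi_n\in\Xi$, $\rho>0$, $f:\mathbb R^p\times\Xi\to\mathbb R$, $c:\Xi\times\Xi\to\mathbb R$, and for each $\xi\in\Xi$ let $\pi_0(\cdot|\xi)$ be a probability measure on $\Xi$. A continuous function is called coercive if all its sublevel sets are compact. Assume: 1. For each $y\in\{1,\dots,J\}$, the function $(\theta,x)\mapsto f(\theta,(x,y))$ is continuously differentiable on $\mathbb R^p\times\mathbb R^d$. 2. $c$ is non-negative and continuous. For each $\xi\in\Xi$, $c(\xi,\xi)=0$, $c(\xi,\cdot)$ is coercive, and there are constants $\mu_\xi\in\mathbb R$, $\lambda_\xi\ge 0$ with $f(\theta,\zeta)\le\mu_\xi+\frac{\lambda_\xi}{2}c(\xi,\zeta)$ for all $\theta\in\Theta$, $\zeta\in\Xi$. 3. For all $\xi\in\Xi$ and $y'\in\{1,\dots,J\}$, Lebesgue measure on $\mathbb R^d$ is absolutely continuous with respect to the measure $A\mapsto\pi_0(A\times\{y'\}|\xi)$.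 Moreover there are $a>0$ and a continuous coercive $\psi:\Xi\to\mathbb R$ such that for all $\xi\in\Xi$: $\mathbb E_{\zeta\sim\pi_0(\cdot|\xi)}[c(\xi,\zeta)^{1+a}]<\infty$, $\ \sup_{\theta\in\Theta}\|\nabla_\theta f(\theta,\xi)\|<\psi(\xi)$, and $\mathbb E_{\zeta\sim\pi_0(\cdot|\xi)}[\psi(\zeta)^{1+a}]<\infty$. Fix such constants $\lambda_\xi$ and $\lambda_{\max}>0$, put $\Lambda=\bigcap_{i=1}^n[\lambda_{\xi_i},\lambda_{\max}]$ and $\mathcal K=\Theta\times\Lambda$, and assume $\Lambda\subset(0,\infty)$. For $\beta>0$ define $$F(\theta,\lambda)=\lambda\rho+\frac1n\sum_{i=1}^n\sup_{\zeta\in\Xi}\{f(\theta,\zeta)-\lambda c(\xi_i,\zeta)\},\qquad F^\beta(\theta,\lambda)=\lambda\rho+\frac1n\sum_{i=1}^n\beta\log\mathbb E_{\zeta\sim\pi_0(\cdot|\xi_i)}\Big[e^{(f(\theta,\zeta)-\lambda c(\xi_i,\zeta))/\beta}\Big].$$ Both are regarded as functions on $D=\Theta\times[0,\infty)\subset\mathbb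 R^{p+1}$ (near $\mathcal K$, that is, on a relative neighbourhood of $\mathcal K$ in $D$, they are finite). For a function $g$ on $D$ and $w\in\mathcal K$, the Clarke subdifferential $\partial^c g(w)$ is the convex hull of all limits $\lim_k s_k$, where $w_k\in D$, $w_k\to w$ and $s_k$ is a gradient of $g$ at $w_k$ relative to $D$, i.e. $g(u)=g(w_k)+\langle s_k,u-w_k\rangle+o(\|u-w_k\|)$ as $u\to w_k$ in $D$ (the usual gradient if $w_k$ is an interior point of $D$, so that $\partial^c g(w)$ is the usual Clarke subdifferential if $w$ is interior to $D$). Let $N_{\mathcal K}(w)=\{v:\langle v,u-w\rangle\le 0\ \forall u\in\mathcal K\}$ be the normal cone and $\operatorname{crit} g_{|\mathcal K}=\{w\in\mathcal K:0\in\partial^c g(w)+N_{\mathcal K}(w)\}$. **Theorem.** For every $\epsilon>0$ there is $\bar\beta>0$ such that for all $\beta\in(0,\bar\beta]$, $$\operatorname{crit}F^\beta_{|\mathcal K}\subset\operatorname{crit}F_{|\mathcal K}+\epsilon\overline{\mathbb B},$$ where $\overline{\mathbb B}$ is the closed Euclidean unit ball of $\mathbb R^{p+1}$. -/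

import Mathlib

open MeasureTheory Filter Topology
open scoped Pointwise

/-- `ℝ^q` with the Euclidean norm. -/
abbrev Euc (q : ℕ) : Type := EuclideanSpace ℝ (Fin q)

/-- The sample space `ℝ^d × {1, …, J}` (the second factor is discrete). -/
abbrev SampleSpace (d J : ℕ) : Type := Euc d × Fin J

/-- `ℝ^p × ℝ = ℝ^(p+1)` with the Euclidean norm: the space of the pairs `(θ, l)`. -/
abbrev ParamSpace (p : ℕ) : Type := WithLp 2 (Euc p × ℝ)

section Clarke

variable {V : Type*} [NormedAddCommGroup V] [InnerProductSpace ℝ V] [CompleteSpace V]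

/-- The Clarke subdifferential at `w` of a function `g` with domain `D`: the convex hull of the
limits of gradients of `g` along sequences of `D` that converge to `w`.
For `D = univ`, and more generally if `D` is a neighbourhood of `w`, this is the usual Clarke
subdifferential. The values of `g` outside `D` play no role; at a point of `D` that
is not interior, "gradient" means a vector `s` with
`g (u') = g u + ⟪s, u' - u⟫ + o(‖u' - u‖)` for `u' ∈ D`. -/
def clarkeSubdifferential (D : Set V) (g : V → ℝ) (w : V) : Set V :=
  convexHull ℝ {v | ∃ u s : ℕ → V,
    (∀ k, u k ∈ D ∧ HasGradientWithinAt g (s k) D (u k)) ∧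
    Tendsto s atTop (𝓝 v) ∧ Tendsto u atTop (𝓝 w)}

/-- The normal cone at `w` to a convex set `K`. -/
def normalCone (K : Set V) (w : V) : Set V :=
  {v | ∀ u ∈ K, inner ℝ v (u - w) ≤ 0}

/-- The critical points, restricted to `K`, of a function `g` with domain `D ⊇ K`. -/
def crit (D : Set V) (g : V → ℝ) (K : Set V) : Set V :=
  {w | w ∈ K ∧ (0 : V) ∈ clarkeSubdifferential D g w + normalCone K w}

end Clarke

section WDRO

variable {p d J n : ℕ}

/-- A continuous function all of whose sublevel sets are compact. -/
def IsCoerciveFun {X : Type*} [TopologicalSpace X] (ψ : X → ℝ) : Prop :=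
  Continuous ψ ∧ ∀ r : ℝ, IsCompact {x | ψ x ≤ r}

/-- The smoothness, growth and reference distribution assumptions on the loss `f`, the cost `c`
and the conditional distributions `π₀ ξ`; `lam ξ` is the constant of the growth condition
`f θ ζ ≤ μ_ξ + (lam ξ / 2) * c ξ ζ`. -/
structure WDROAssumption (Θ : Set (Euc p)) (f : Euc p → SampleSpace d J → ℝ)
    (c : SampleSpace d J → SampleSpace d J → ℝ)
    (π₀ : SampleSpace d J → Measure (SampleSpace d J))
    (lam : SampleSpace d J → ℝ) : Prop where
  smooth : ∀ y : Fin J, ContDiff ℝ 1 (fun q : Euc p × Euc d => f q.1 (q.2, y))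
  cost_nonneg : ∀ ξ ζ, 0 ≤ c ξ ζ
  cost_continuous : Continuous (fun q : SampleSpace d J × SampleSpace d J => c q.1 q.2)
  cost_self : ∀ ξ, c ξ ξ = 0
  cost_coercive : ∀ ξ, IsCoerciveFun (c ξ)
  lam_nonneg : ∀ ξ, 0 ≤ lam ξ
  growth : ∀ ξ, ∃ μ : ℝ, ∀ θ ∈ Θ, ∀ ζ, f θ ζ ≤ μ + lam ξ / 2 * c ξ ζ
  /-- Each `π₀ ξ` charges every set `A × {y}` with `A` not Lebesgue-null, that is, Lebesgue measure
  is absolutely continuous with respect to `A ↦ π₀ ξ (A × {y})`. -/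
  lebesgue_ac : ∀ ξ, ∀ y : Fin J, (volume : Measure (Euc d)) ≪
    ((π₀ ξ).restrict (Set.univ ×ˢ {y})).map Prod.fst
  moments : ∃ a : ℝ, 0 < a ∧ ∃ ψ : SampleSpace d J → ℝ, IsCoerciveFun ψ ∧
    (∀ ξ, Integrable (fun ζ => c ξ ζ ^ (1 + a)) (π₀ ξ)) ∧
    (∀ ζ, ∀ θ ∈ Θ, ‖gradient (fun θ' => f θ' ζ) θ‖ < ψ ζ) ∧
    (∀ ξ, Integrable (fun ζ => ψ ζ ^ (1 + a)) (π₀ ξ))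

/-- `φ_ξ(θ, l) = sup_ζ (f(θ, ζ) - l c(ξ, ζ))`. -/
noncomputable def dualFun (f : Euc p → SampleSpace d J → ℝ)
    (c : SampleSpace d J → SampleSpace d J → ℝ) (ξ : SampleSpace d J) (θ : Euc p) (l : ℝ) : ℝ :=
  ⨆ ζ, (f θ ζ - l * c ξ ζ)

/-- `φ^β_ξ(θ, l) = β log E_{ζ ∼ π₀(·|ξ)} exp ((f(θ, ζ) - l c(ξ, ζ)) / β)`. -/
noncomputable def smoothDualFun (f : Euc p → SampleSpace d J → ℝ)
    (c : SampleSpace d J → SampleSpace d J → ℝ)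
    (π₀ : SampleSpace d J → Measure (SampleSpace d J)) (β : ℝ)
    (ξ : SampleSpace d J) (θ : Euc p) (l : ℝ) : ℝ :=
  β * Real.log (∫ ζ, Real.exp ((f θ ζ - l * c ξ ζ) / β) ∂(π₀ ξ))

/-- `F(θ, l) = l ρ + (1/n) ∑ᵢ φ_{ξᵢ}(θ, l)`. -/
noncomputable def objective (f : Euc p → SampleSpace d J → ℝ)
    (c : SampleSpace d J → SampleSpace d J → ℝ) (ρ : ℝ)
    (ξ : Fin n → SampleSpace d J) (w : ParamSpace p) : ℝ :=
  w.snd * ρ + (1 / (n : ℝ)) * ∑ i, dualFun f c (ξ i) w.fst w.snd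

/-- `F^β(θ, l) = l ρ + (1/n) ∑ᵢ φ^β_{ξᵢ}(θ, l)`. -/
noncomputable def regObjective (f : Euc p → SampleSpace d J → ℝ)
    (c : SampleSpace d J → SampleSpace d J → ℝ)
    (π₀ : SampleSpace d J → Measure (SampleSpace d J)) (ρ β : ℝ)
    (ξ : Fin n → SampleSpace d J) (w : ParamSpace p) : ℝ :=
  w.snd * ρ + (1 / (n : ℝ)) * ∑ i, smoothDualFun f c π₀ β (ξ i) w.fst w.snd

/-- `Λ = ⋂ᵢ [lam ξᵢ, lamMax]`. -/
def dualSegment (lam : SampleSpace d J → ℝ) (lamMax : ℝ) (ξ : Fin n → SampleSpace d J) : Set ℝ :=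
  ⋂ i, Set.Icc (lam (ξ i)) lamMax

/-- `Θ × L` as a subset of the Euclidean space `ℝ^p × ℝ`. -/
def paramProd (Θ : Set (Euc p)) (L : Set ℝ) : Set (ParamSpace p) :=
  {w | w.fst ∈ Θ ∧ w.snd ∈ L}

end WDRO

/-!
The functions `F` and `F^β` are averages of maxima and of soft maxima over `ζ` of the functions
`G_i (w, ζ) = f (θ, ζ) - l c (ξ_i, ζ)`, `w = (θ, l)`. By compactness it suffices that a limit `w` of
critical points of `F^β` with `β → 0` is critical for `F` (`mem_crit_objective_of_frequently`). Fix
`u ∈ K`, and let `m` be the slope of `F` at `w` towards `u`, that is, `ρ` times the last coordinate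
of `u - w` plus the average over `i` of the largest `⟪∇G_i (w, ζ), u - w⟫` over the maximisers `ζ`
of `G_i (w, ·)`.

* By Jensen's inequality the increments of a soft maximum are at most the Gibbs means of the
  increments of `G_i` (`log_integral_exp_sub_le`). The Gibbs measures concentrate near the
  maximisers, so gradients of `F^β` near `w` have slope at most `m + ε` towards `u`
  (`IsTightFamily.exists_softMax_slope_le`). Criticality of nearby points for `F^β` then gives
  `0 ≤ m` (`nonneg_of_mem_crit`). This does not require `F^β` to be differentiable, and it is
  unaffected by the non-uniqueness of gradients relative to a domain with empty interior.
* Conversely `F` increases from `w` towards `u` with slope at least `m`, hence there are gradients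
  of `F` at points near `w` with slope at least `m - ε` towards `u` (`exists_gradient_of_slope`).
  Indeed, maximising `F x - m' τ - N ‖x - (a + τ (b - a))‖ ^ 2`, with `[a, b]` a segment in the
  relative interior of the domain, gives a point where a smooth function of the right slope touches
  `F` from above (`exists_quadratic_touching_above`). An active `G_i` touches from below, so `F` is
  differentiable there.
* So for every `u ∈ K` some limit of bounded gradients has nonnegative slope towards `u`. Sion's
  minimax theorem provides one convex combination of such limits that works for all `u`
  (`zero_mem_convexHull_add_normalCone`), which is criticality for `F`.
-/

/-! ### One-sided gradients relative to a convex set -/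

section ConvexAnalysis

variable {V : Type*} [NormedAddCommGroup V] [InnerProductSpace ℝ V]

/-- `s` is a Fréchet subgradient at `x` of the restriction of `F` to `D`:
`F u ≥ F x + ⟪s, u - x⟫ - o(‖u - x‖)` as `u → x` in `D`. -/
def IsFrechetSubgradient (D : Set V) (F : V → ℝ) (s x : V) : Prop :=
  ∀ ε : ℝ, 0 < ε → ∀ᶠ u in 𝓝[D] x, F x + inner ℝ s (u - x) - ε * ‖u - x‖ ≤ F u

theorem Convex.tendsto_segment {D : Set V} (hD : Convex ℝ D) {x u : V} (hx : x ∈ D) (hu : u ∈ D) :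
    Tendsto (fun t : ℝ => x + t • (u - x)) (𝓝[>] 0) (𝓝[D] x) := by
  refine tendsto_nhdsWithin_iff.2 ⟨?_, ?_⟩
  · have h : Continuous (fun t : ℝ => x + t • (u - x)) := by fun_prop
    have := h.tendsto 0
    simp only [zero_smul, add_zero] at this
    exact this.mono_left nhdsWithin_le_nhds
  · filter_upwards [Ioo_mem_nhdsGT (zero_lt_one' ℝ)] with t ht
    exact hD.add_smul_sub_mem hx hu ⟨ht.1.le, ht.2.le⟩

/-- A function grows along a segment at least as fast as a Fréchet subgradient predicts. -/
theorem IsFrechetSubgradient.eventually_lt {D : Set V} (hD : Convex ℝ D) {F : V → ℝ} {s x u : V}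
    (hs : IsFrechetSubgradient D F s x) (hx : x ∈ D) (hu : u ∈ D) {r : ℝ}
    (hr : r < inner ℝ s (u - x)) :
    ∀ᶠ t : ℝ in 𝓝[>] 0, t * r < F (x + t • (u - x)) - F x := by
  set ε := (inner ℝ s (u - x) - r) / (‖u - x‖ + 1) with hε
  have hp : 0 < ‖u - x‖ + 1 := by positivity
  have hε0 : 0 < ε := div_pos (by linarith) hp
  have hεr : ε * ‖u - x‖ < inner ℝ s (u - x) - r := by
    have : ε * (‖u - x‖ + 1) = inner ℝ s (u - x) - r := div_mul_cancel₀ _ hp.ne'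
    linarith
  filter_upwards [(hD.tendsto_segment hx hu).eventually (hs ε hε0), self_mem_nhdsWithin]
    with t h1 ht
  have ht' : (0 : ℝ) < t := ht
  simp only [add_sub_cancel_left, inner_smul_right, norm_smul, Real.norm_eq_abs,
    abs_of_pos ht'] at h1
  have h2 := mul_lt_mul_of_pos_left hεr ht'
  linarith

/-- A Fréchet subgradient is bounded by every one-sided slope bound of the function. -/
theorem IsFrechetSubgradient.inner_le {D : Set V} (hD : Convex ℝ D) {F : V → ℝ} {s x u : V}
    (hs : IsFrechetSubgradient D F s x) (hx : x ∈ D) (hu : u ∈ D) {m : ℝ}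
    (hm : ∀ᶠ t : ℝ in 𝓝[>] 0, F (x + t • (u - x)) - F x ≤ t * m) :
    inner ℝ s (u - x) ≤ m := by
  by_contra! h
  obtain ⟨t, h1, h2⟩ := ((hs.eventually_lt hD hx hu h).and hm).exists
  linarith

theorem HasGradientWithinAt.isFrechetSubgradient [CompleteSpace V] {D : Set V} {F : V → ℝ}
    {s x : V} (h : HasGradientWithinAt F s D x) : IsFrechetSubgradient D F s x := by
  intro ε hε
  filter_upwards [(hasGradientWithinAt_iff_isLittleO.1 h).bound hε] with u hu
  have := neg_le_of_abs_le hu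
  linarith

theorem IsFrechetSubgradient.add {D : Set V} {F G : V → ℝ} {s t x : V}
    (hF : IsFrechetSubgradient D F s x) (hG : IsFrechetSubgradient D G t x) :
    IsFrechetSubgradient D (fun u => F u + G u) (s + t) x := by
  intro ε hε
  filter_upwards [hF (ε / 2) (half_pos hε), hG (ε / 2) (half_pos hε)] with u h1 h2
  rw [inner_add_left]
  linarith

theorem IsFrechetSubgradient.const_mul {D : Set V} {F : V → ℝ} {s x : V}
    (hF : IsFrechetSubgradient D F s x) {a : ℝ} (ha : 0 < a) :
    IsFrechetSubgradient D (fun u => a * F u) (a • s) x := by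
  intro ε hε
  filter_upwards [hF (ε / a) (by positivity)] with u h
  rw [real_inner_smul_left]
  have := mul_le_mul_of_nonneg_left h ha.le
  have e : a * (ε / a * ‖u - x‖) = ε * ‖u - x‖ := by field_simp
  linarith [mul_sub a (F x + inner ℝ s (u - x)) (ε / a * ‖u - x‖),
    mul_add a (F x) (inner ℝ s (u - x))]

theorem IsFrechetSubgradient.sum {D : Set V} {ι : Type*} (I : Finset ι) {F : ι → V → ℝ}
    {s : ι → V} {x : V} (h : ∀ i ∈ I, IsFrechetSubgradient D (F i) (s i) x) :
    IsFrechetSubgradient D (fun u => ∑ i ∈ I, F i u) (∑ i ∈ I, s i) x := by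
  classical
  induction I using Finset.induction_on with
  | empty =>
    intro ε hε
    filter_upwards with u
    simp only [Finset.sum_empty, inner_zero_left]
    have : 0 ≤ ε * ‖u - x‖ := by positivity
    linarith
  | insert i I hi ih =>
    simp only [Finset.sum_insert hi]
    exact (h i (Finset.mem_insert_self i I)).add
      (ih fun j hj => h j (Finset.mem_insert_of_mem hj))

/-- If a function admits at `x` a Fréchet subgradient `s` and is bounded above to first order by
an affine function of slope `p`, and if every direction of `D` at `x` can be reversed, then `s` and
`p` agree on `D` and `s` is a gradient. -/
theorem IsFrechetSubgradient.hasGradientWithinAt [CompleteSpace V] {D : Set V} (hD : Convex ℝ D)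
    {F : V → ℝ} {s p x : V} (hx : x ∈ D) (hrev : ∀ u ∈ D, ∃ κ : ℝ, 0 < κ ∧ x - κ • (u - x) ∈ D)
    (hs : IsFrechetSubgradient D F s x)
    (hp : IsFrechetSubgradient D (fun u => -F u) (-p) x) :
    (∀ u ∈ D, inner ℝ s (u - x) = inner ℝ p (u - x)) ∧ HasGradientWithinAt F s D x := by
  have hdiff : IsFrechetSubgradient D (fun _ => (0 : ℝ)) (s - p) x := by
    have := hs.add hp
    simpa only [add_neg_cancel, sub_eq_add_neg] using this
  have hle : ∀ u ∈ D, inner ℝ (s - p) (u - x) ≤ 0 := fun u hu =>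
    hdiff.inner_le hD hx hu (m := 0) (by simp)
  have heq : ∀ u ∈ D, inner ℝ s (u - x) = inner ℝ p (u - x) := by
    intro u hu
    obtain ⟨κ, hκ, hm⟩ := hrev u hu
    have h1 := hle u hu
    have h2 := hle _ hm
    rw [sub_sub_cancel_left, inner_neg_right, inner_smul_right] at h2
    have h3 : 0 ≤ inner ℝ (s - p) (u - x) := by
      by_contra! hneg
      nlinarith
    have h4 := le_antisymm h1 h3
    rw [inner_sub_left] at h4
    linarith
  refine ⟨heq, hasGradientWithinAt_iff_isLittleO.2 (Asymptotics.isLittleO_iff.2 fun ε hε => ?_)⟩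
  filter_upwards [hs ε hε, hp ε hε, self_mem_nhdsWithin] with u h1 h2 hu
  rw [inner_neg_left, ← heq u hu] at h2
  rw [Real.norm_eq_abs, abs_le]
  constructor <;> linarith

/-! ### A mean value inequality for smooth functions touching from above -/

/-- If `F b - F a > m`, then at some point near the segment `[a, b]` the function `F` is touched
from above by a quadratic function of slope at least `m` along `b - a`: maximise
`F x - m τ - N ‖x - (a + τ (b - a))‖ ^ 2` in `(x, τ)`. -/
theorem exists_quadratic_touching_above {X : Set V} (hX : IsCompact X) {F : V → ℝ}
    (hF : ContinuousOn F X) {a b : V} (ha : a ∈ X) (hb : b ∈ X) {m : ℝ} (hm : m < F b - F a)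
    {r : ℝ} (hr : 0 < r) :
    ∃ τ ∈ Set.Icc (0 : ℝ) 1, ∃ x ∈ X, ‖x - (a + τ • (b - a))‖ < r ∧ ∃ p : V, ∃ N : ℝ,
      (∀ z ∈ X, F z ≤ F x + inner ℝ p (z - x) + N * ‖z - x‖ ^ 2) ∧ m ≤ inner ℝ p (b - a) := by
  obtain ⟨M, hM⟩ := hX.exists_bound_of_continuousOn hF
  have hM' : ∀ x ∈ X, |F x| ≤ M := hM
  obtain ⟨δ, hδ, hδF⟩ := Metric.continuousWithinAt_iff.1 (hF a ha) (F b - F a - m) (by linarith)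
  set r' := min δ r with hr'
  have hr'0 : 0 < r' := lt_min hδ hr
  have hM0 : 0 ≤ M := (abs_nonneg _).trans (hM' a ha)
  -- so large that a maximiser of the penalised function is at distance less than `r'`
  set N : ℝ := (2 * M + |m| + 1) / r' ^ 2 with hN
  have hN0 : 0 < N := by positivity
  have hNr : N * r' ^ 2 = 2 * M + |m| + 1 := by rw [hN]; field_simp
  let Φ : V × ℝ → ℝ := fun q => F q.1 - m * q.2 - N * ‖q.1 - (a + q.2 • (b - a))‖ ^ 2
  have hΦ : ContinuousOn Φ (X ×ˢ Set.Icc (0 : ℝ) 1) := by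
    have h1 : ContinuousOn (fun q : V × ℝ => F q.1) (X ×ˢ Set.Icc (0 : ℝ) 1) :=
      hF.comp continuousOn_fst fun q hq => hq.1
    have h2 : Continuous fun q : V × ℝ => m * q.2 := by fun_prop
    have h3 : Continuous fun q : V × ℝ => N * ‖q.1 - (a + q.2 • (b - a))‖ ^ 2 := by fun_prop
    exact (h1.sub h2.continuousOn).sub h3.continuousOn
  obtain ⟨⟨x, τ⟩, ⟨hx, hτ⟩, hmax⟩ := (hX.prod isCompact_Icc).exists_isMaxOn
    ⟨(b, 1), hb, by simp⟩ hΦ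
  have hmax' : ∀ z ∈ X, ∀ σ ∈ Set.Icc (0 : ℝ) 1, F z - m * σ - N * ‖z - (a + σ • (b - a))‖ ^ 2 ≤
      F x - m * τ - N * ‖x - (a + τ • (b - a))‖ ^ 2 := fun z hz σ hσ => hmax (Set.mk_mem_prod hz hσ)
  simp only at hx hτ
  have hb1 := hmax' b hb 1 (by simp)
  simp only [one_smul, add_sub_cancel, sub_self, norm_zero] at hb1
  set e := x - (a + τ • (b - a)) with he
  have hmτ : m * (1 - τ) ≤ |m| := by
    calc m * (1 - τ) ≤ |m| * (1 - τ) := by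
          gcongr
          · linarith [hτ.2]
          · exact le_abs_self m
      _ ≤ |m| * 1 := by gcongr; linarith [hτ.1]
      _ = |m| := mul_one _
  have her : ‖e‖ < r' := by
    by_contra! hge
    have h1 : N * r' ^ 2 ≤ N * ‖e‖ ^ 2 := by gcongr
    have h2 := (abs_le.1 (hM' x hx)).2
    have h3 := (abs_le.1 (hM' b hb)).1
    linarith
  -- at `τ = 0` the maximal value would be close to `F a`, which is less than `F b - m`
  have hτ0 : 0 < τ := by
    rcases hτ.1.eq_or_lt with h0 | h0
    · exfalso
      have hxa : e = x - a := by rw [he, ← h0]; simp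
      have h4 : dist x a < δ := by
        rw [dist_eq_norm, ← hxa]
        exact her.trans_le (min_le_left _ _)
      have h5 := (abs_lt.1 (hδF hx h4)).2
      have h6 : 0 ≤ N * ‖e‖ ^ 2 := by positivity
      rw [← h0] at hb1
      linarith
    · exact h0
  refine ⟨τ, hτ, x, hx, her.trans_le (min_le_right _ _), (2 * N) • e, N, ?_, ?_⟩
  · intro z hz
    have h1 := hmax' z hz τ hτ
    have h2 : z - (a + τ • (b - a)) = e + (z - x) := by rw [he]; abel
    rw [h2, norm_add_sq_real] at h1
    rw [real_inner_smul_left]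
    linarith
  -- the slope of the touching quadratic follows by comparison with `(x, τ - σ)`, `σ → 0`
  · rw [real_inner_smul_left]
    refine le_of_forall_pos_le_add fun η hη => ?_
    set q := N * ‖b - a‖ ^ 2 with hq
    have hq0 : 0 ≤ q := by positivity
    set σ := min τ (η / (q + 1)) with hσ
    have hσ0 : 0 < σ := lt_min hτ0 (by positivity)
    have h1 := hmax' x hx (τ - σ) ⟨by linarith [min_le_left τ (η / (q + 1))], by linarith [hτ.2]⟩
    have h2 : x - (a + (τ - σ) • (b - a)) = e + σ • (b - a) := by
      rw [he, sub_smul]; abel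
    rw [h2, norm_add_sq_real, inner_smul_right, norm_smul, mul_pow, Real.norm_eq_abs, sq_abs] at h1
    have h3 : σ * m ≤ σ * (2 * N * inner ℝ e (b - a) + σ * q) := by
      rw [hq]; nlinarith
    have h4 : σ * q ≤ η := by
      have : σ * (q + 1) ≤ η := by
        rw [← le_div_iff₀ (by positivity)]
        exact min_le_right _ _
      nlinarith
    linarith [le_of_mul_le_mul_left h3 hσ0]

/-! ### Relative interiors -/

/-- If `D` contains the points of its affine span at distance less than `r` from `w₀`, then every
point `x` of `D` close to the contraction of `z ∈ D` towards `w₀` is a relative interior point: from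
`x`, every direction into `D` can be reversed. -/
theorem Convex.exists_reverse_of_near {D : Set V} (hD : Convex ℝ D) {w₀ : V} {r : ℝ}
    (hball : ∀ x ∈ affineSpan ℝ D, ‖x - w₀‖ < r → x ∈ D) (hw₀ : w₀ ∈ D) {z x : V} (hz : z ∈ D)
    (hx : x ∈ D) {η : ℝ} (hη : 0 < η) (hη1 : η ≤ 1)
    (hxz : ‖x - (z + η • (w₀ - z))‖ < η * r) {u : V} (hu : u ∈ D) :
    ∃ κ : ℝ, 0 < κ ∧ x - κ • (u - x) ∈ D := by
  set e := x - (z + η • (w₀ - z)) with he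
  have hlim : Tendsto (fun κ : ℝ => ‖e - κ • (u - x)‖) (𝓝[>] 0) (𝓝 ‖e‖) := by
    have h : Continuous (fun κ : ℝ => ‖e - κ • (u - x)‖) := by fun_prop
    have := h.tendsto 0
    simp only [zero_smul, sub_zero] at this
    exact this.mono_left nhdsWithin_le_nhds
  obtain ⟨κ, hκ, hκ0⟩ := ((hlim.eventually_lt_const hxz).and self_mem_nhdsWithin).exists
  refine ⟨κ, hκ0, ?_⟩
  have hsub := subset_affineSpan ℝ D
  have hdir : ∀ y ∈ D, ∀ y' ∈ D, y - y' ∈ (affineSpan ℝ D).direction := fun y hy y' hy' =>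
    AffineSubspace.vsub_mem_direction (hsub hy) (hsub hy')
  have hy : w₀ + η⁻¹ • (e - κ • (u - x)) ∈ D := by
    apply hball
    · have h1 : e - κ • (u - x) ∈ (affineSpan ℝ D).direction := by
        have h2 : e = (x - z) - η • (w₀ - z) := by rw [he]; abel
        rw [h2]
        exact sub_mem (sub_mem (hdir x hx z hz) (Submodule.smul_mem _ _ (hdir w₀ hw₀ z hz)))
          (Submodule.smul_mem _ _ (hdir u hu x hx))
      have h3 := AffineSubspace.vadd_mem_of_mem_direction
        (Submodule.smul_mem _ η⁻¹ h1) (hsub hw₀)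
      rwa [vadd_eq_add, add_comm] at h3
    · rw [add_sub_cancel_left, norm_smul, norm_inv, Real.norm_eq_abs, abs_of_pos hη,
        inv_mul_lt_iff₀ hη]
      exact hκ
  have h4 := hD.add_smul_sub_mem hz hy ⟨hη.le, hη1⟩
  have h5 : z + η • (w₀ + η⁻¹ • (e - κ • (u - x)) - z) = x - κ • (u - x) := by
    have : η • η⁻¹ • (e - κ • (u - x)) = e - κ • (u - x) := smul_inv_smul₀ hη.ne' _
    rw [add_sub_right_comm, smul_add, this, he]
    abel
  rwa [h5] at h4

theorem exists_ball_of_mem_intrinsicInterior {D : Set V} {w₀ : V}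
    (h : w₀ ∈ intrinsicInterior ℝ D) :
    ∃ r : ℝ, 0 < r ∧ ∀ x ∈ affineSpan ℝ D, ‖x - w₀‖ < r → x ∈ D := by
  obtain ⟨y, hy, rfl⟩ := mem_intrinsicInterior.1 h
  obtain ⟨r, hr, hsub⟩ := Metric.mem_nhds_iff.1 (mem_interior_iff_mem_nhds.1 hy)
  refine ⟨r, hr, fun x hx hxr => ?_⟩
  have : (⟨x, hx⟩ : affineSpan ℝ D) ∈ Metric.ball y r := by
    rw [Metric.mem_ball, Subtype.dist_eq, dist_eq_norm]
    exact hxr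
  exact hsub this

/-! ### Gradients in a prescribed half-space -/

/-- If `F` grows from `w` towards `u` with slope more than `r`, then arbitrarily near `w` there are
points of `D` at which `F` has a gradient whose slope along `u - w` is at least `r`. -/
theorem exists_gradient_of_slope [FiniteDimensional ℝ V] {D : Set V} (hD : Convex ℝ D)
    (hDc : IsClosed D) {F : V → ℝ} {w u : V} (hw : w ∈ D) (hu : u ∈ D) {δ R : ℝ} (hδ : 0 < δ)
    (hF : ContinuousOn F (D ∩ Metric.closedBall w δ))
    (hsub : ∀ x ∈ D ∩ Metric.closedBall w δ, ∃ s, ‖s‖ ≤ R ∧ IsFrechetSubgradient D F s x)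
    {r : ℝ} (hr : ∀ᶠ t : ℝ in 𝓝[>] 0, t * r < F (w + t • (u - w)) - F w) :
    ∃ x ∈ D, ‖x - w‖ < δ ∧ ∃ s, ‖s‖ ≤ R ∧ HasGradientWithinAt F s D x ∧
      r ≤ inner ℝ s (u - w) := by
  obtain ⟨w₀, hw₀⟩ := Set.Nonempty.intrinsicInterior hD ⟨w, hw⟩
  have hw₀D := intrinsicInterior_subset hw₀
  obtain ⟨r₁, hr₁, hball⟩ := exists_ball_of_mem_intrinsicInterior hw₀
  set X := D ∩ Metric.closedBall w δ with hXdef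
  have hX : IsCompact X := (isCompact_closedBall w δ).inter_left hDc
  have hsmall : ∀ᶠ t : ℝ in 𝓝[>] 0, ‖t • (u - w)‖ < δ / 4 := by
    have h : Continuous (fun t : ℝ => ‖t • (u - w)‖) := by fun_prop
    have h0 := h.tendsto 0
    simp only [zero_smul, norm_zero] at h0
    exact (h0.mono_left nhdsWithin_le_nhds).eventually_lt_const (by positivity)
  obtain ⟨t, ⟨⟨hrt, hts⟩, ht1⟩⟩ := ((hr.and hsmall).and (Ioo_mem_nhdsGT (zero_lt_one' ℝ))).exists
  have ht0 : 0 < t := ht1.1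
  set b := w + t • (u - w) with hb
  have hbD : b ∈ D := hD.add_smul_sub_mem hw hu ⟨ht0.le, ht1.2.le⟩
  have hbw : b - w = t • (u - w) := by rw [hb]; abel
  have hbwn : ‖b - w‖ < δ / 4 := by rw [hbw]; exact hts
  have hwX : w ∈ X := ⟨hw, by simp [hδ.le]⟩
  -- move the segment `[w, b]` slightly towards a relative interior point
  have hcont : ∀ z ∈ D, ‖z - w‖ < δ / 4 →
      Tendsto (fun η : ℝ => F (z + η • (w₀ - z))) (𝓝[>] 0) (𝓝 (F z)) := by
    intro z hz hzw
    have hz' : z ∈ Metric.ball w δ := by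
      rw [Metric.mem_ball, dist_eq_norm]; linarith
    have hzX : z ∈ X := ⟨hz, Metric.ball_subset_closedBall hz'⟩
    have h1 : 𝓝[D] z = 𝓝[X] z :=
      (nhdsWithin_inter_of_mem' (mem_nhdsWithin_of_mem_nhds
        (Filter.mem_of_superset (Metric.isOpen_ball.mem_nhds hz')
          Metric.ball_subset_closedBall))).symm
    have h2 := hD.tendsto_segment hz hw₀D
    rw [h1] at h2
    exact (hF z hzX).tendsto.comp h2
  have hgap : ∀ᶠ η : ℝ in 𝓝[>] 0,
      (1 - η) * (t * r) < F (b + η • (w₀ - b)) - F (w + η • (w₀ - w)) := by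
    have h1 : Tendsto (fun η : ℝ => (1 - η) * (t * r)) (𝓝[>] 0) (𝓝 ((1 - 0) * (t * r))) := by
      have h : Continuous (fun η : ℝ => (1 - η) * (t * r)) := by fun_prop
      exact (h.tendsto 0).mono_left nhdsWithin_le_nhds
    rw [sub_zero, one_mul] at h1
    exact h1.eventually_lt ((hcont b hbD hbwn).sub
      (hcont w hw (by simpa using by positivity))) hrt
  have hnear : ∀ᶠ η : ℝ in 𝓝[>] 0, ‖η • (w₀ - w)‖ < δ / 4 := by
    have h : Continuous (fun η : ℝ => ‖η • (w₀ - w)‖) := by fun_prop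
    have h0 := h.tendsto 0
    simp only [zero_smul, norm_zero] at h0
    exact (h0.mono_left nhdsWithin_le_nhds).eventually_lt_const (by positivity)
  obtain ⟨η, ⟨⟨hgapη, hnearη⟩, hη⟩⟩ :=
    ((hgap.and hnear).and (Ioo_mem_nhdsGT (zero_lt_one' ℝ))).exists
  have hη0 : 0 < η := hη.1
  have hη1 : η < 1 := hη.2
  set a' := w + η • (w₀ - w) with ha'
  set b' := b + η • (w₀ - b) with hb'
  have hba : b' - a' = ((1 - η) * t) • (u - w) := by
    rw [mul_smul, ← hbw, hb', ha', sub_smul, one_smul, smul_sub, smul_sub, smul_sub]; abel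
  have hpos : 0 < (1 - η) * t := mul_pos (by linarith) ht0
  have hseg : ∀ τ ∈ Set.Icc (0 : ℝ) 1, ‖a' + τ • (b' - a') - w‖ < δ / 2 := by
    intro τ hτ
    have h1 : a' + τ • (b' - a') - w = η • (w₀ - w) + (τ * (1 - η)) • (b - w) := by
      rw [hba, ha', hbw, smul_smul, smul_smul]
      rw [show τ * ((1 - η) * t) = τ * (1 - η) * t by ring]; abel
    rw [h1]
    refine (norm_add_le _ _).trans_lt ?_
    have h2 : ‖(τ * (1 - η)) • (b - w)‖ ≤ 1 * ‖b - w‖ := by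
      rw [norm_smul, Real.norm_eq_abs, abs_of_nonneg (mul_nonneg hτ.1 (by linarith))]
      gcongr
      exact mul_le_one₀ hτ.2 (by linarith) (by linarith)
    linarith
  have ha'D : a' ∈ D := hD.add_smul_sub_mem hw hw₀D ⟨hη0.le, hη1.le⟩
  have hb'D : b' ∈ D := hD.add_smul_sub_mem hbD hw₀D ⟨hη0.le, hη1.le⟩
  have ha'X : a' ∈ X := ⟨ha'D, by
    have := hseg 0 (by simp)
    rw [zero_smul, add_zero] at this
    rw [Metric.mem_closedBall, dist_eq_norm]; linarith⟩
  have hb'X : b' ∈ X := ⟨hb'D, by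
    have := hseg 1 (by simp)
    rw [one_smul, add_sub_cancel] at this
    rw [Metric.mem_closedBall, dist_eq_norm]; linarith⟩
  obtain ⟨τ, hτ, x, hxX, hxd, p, N, hquad, hmp⟩ := exists_quadratic_touching_above hX hF ha'X hb'X
    hgapη (r := min (η * r₁) (δ / 2)) (lt_min (by positivity) (by positivity))
  have hxD := hxX.1
  have hxw : ‖x - w‖ < δ := by
    have h1 : x - w = (x - (a' + τ • (b' - a'))) + (a' + τ • (b' - a') - w) := by abel
    rw [h1]
    refine (norm_add_le _ _).trans_lt ?_
    linarith [hseg τ hτ, hxd.trans_le (min_le_right _ _)]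
  have hrev : ∀ z ∈ D, ∃ κ : ℝ, 0 < κ ∧ x - κ • (z - x) ∈ D := by
    intro z hz
    refine hD.exists_reverse_of_near hball hw₀D (hD.add_smul_sub_mem hw hbD hτ) hxD hη0 hη1.le
      ?_ hz
    have h1 : (w + τ • (b - w)) + η • (w₀ - (w + τ • (b - w))) = a' + τ • (b' - a') := by
      rw [hba, mul_smul, ← hbw, ha', sub_smul, one_smul, smul_sub τ (b - w), smul_sub η w₀,
        smul_sub η w₀, smul_add, smul_comm η τ]
      abel
    rw [h1]
    exact hxd.trans_le (min_le_left _ _)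
  obtain ⟨s, hsR, hs⟩ := hsub x hxX
  have hsup : IsFrechetSubgradient D (fun z => -F z) (-p) x := by
    intro ε hε
    have h1 : ∀ᶠ z in 𝓝[D] x, z ∈ Metric.ball w δ :=
      mem_nhdsWithin_of_mem_nhds (Metric.isOpen_ball.mem_nhds (by
        rwa [Metric.mem_ball, dist_eq_norm]))
    have h2 : ∀ᶠ z in 𝓝[D] x, N * ‖z - x‖ < ε := by
      have h : Continuous (fun z : V => N * ‖z - x‖) := by fun_prop
      have h0 := h.tendsto x
      simp only [sub_self, norm_zero, mul_zero] at h0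
      exact (h0.mono_left nhdsWithin_le_nhds).eventually_lt_const hε
    filter_upwards [h1, h2, self_mem_nhdsWithin] with z hz1 hz2 hzD
    have h3 := hquad z ⟨hzD, Metric.ball_subset_closedBall hz1⟩
    rw [inner_neg_left]
    nlinarith [norm_nonneg (z - x)]
  obtain ⟨heq, hgrad⟩ := hs.hasGradientWithinAt hD hxD hrev hsup
  refine ⟨x, hxD, hxw, s, hsR, hgrad, ?_⟩
  have h5 : inner ℝ s (b' - a') = inner ℝ p (b' - a') := by
    have h6 : b' - a' = (b' - x) - (a' - x) := by abel
    rw [h6, inner_sub_right s (b' - x), inner_sub_right p (b' - x), heq b' hb'D, heq a' ha'D]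
  rw [← h5, hba, inner_smul_right] at hmp
  refine le_of_mul_le_mul_left ?_ hpos
  linarith

/-! ### Criticality from directional slopes -/

/-- By Carathéodory's theorem the convex hull is a finite union of continuous images of compact
sets. -/
theorem IsCompact.convexHull_of_finiteDimensional [FiniteDimensional ℝ V] {S : Set V}
    (hS : IsCompact S) : IsCompact (convexHull ℝ S) := by
  have hU : convexHull ℝ S = ⋃ k ∈ Finset.range (Module.finrank ℝ V + 2),
      (fun q : (Fin k → ℝ) × (Fin k → V) => ∑ i, q.1 i • q.2 i) ''
        (stdSimplex ℝ (Fin k) ×ˢ Set.univ.pi fun _ => S) := by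
    refine Set.Subset.antisymm (fun x hx => ?_) ?_
    · obtain ⟨ι, hι, z, a, hz, hind, ha, ha1, rfl⟩ := eq_pos_convex_span_of_mem_convexHull hx
      have hcard := hind.card_le_finrank_succ
      have hle : Module.finrank ℝ (vectorSpan ℝ (Set.range z)) ≤ Module.finrank ℝ V :=
        Submodule.finrank_le _
      have e := Fintype.equivFin ι
      refine Set.mem_biUnion (x := Fintype.card ι)
        (by simp only [Finset.coe_range, Set.mem_Iio]; omega) ?_
      refine ⟨(fun i => a (e.symm i), fun i => z (e.symm i)), ⟨⟨fun i => (ha _).le, ?_⟩, ?_⟩, ?_⟩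
      · rw [← ha1]
        exact e.symm.sum_comp a
      · exact fun i _ => hz ⟨_, rfl⟩
      · exact e.symm.sum_comp fun i => a i • z i
    · refine Set.iUnion₂_subset fun k _ => ?_
      rintro _ ⟨⟨a, z⟩, ⟨ha, hz⟩, rfl⟩
      exact (convex_convexHull ℝ S).sum_mem (fun i _ => ha.1 i) ha.2
        fun i _ => subset_convexHull ℝ S (hz i (Set.mem_univ i))
  rw [hU]
  refine (Finset.range _).isCompact_biUnion fun k _ => ?_
  refine ((isCompact_stdSimplex ℝ (Fin k)).prod (isCompact_univ_pi fun _ => hS)).image ?_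
  fun_prop

/-- Minimax: if every direction from `w` into the compact convex set `K` has a nonnegative product
with some element of the compact set `S`, then a single convex combination of elements of `S` has
nonnegative products with all of these directions. -/
theorem zero_mem_convexHull_add_normalCone [FiniteDimensional ℝ V] {S K : Set V}
    (hS : IsCompact S) (hK : IsCompact K) (hKc : Convex ℝ K) {w : V} (hw : w ∈ K)
    (h : ∀ u ∈ K, ∃ s ∈ S, 0 ≤ inner ℝ s (u - w)) :
    (0 : V) ∈ convexHull ℝ S + normalCone K w := by
  obtain ⟨s₀, hs₀, -⟩ := h w hw
  have hcvx : Convex ℝ (convexHull ℝ S) := convex_convexHull ℝ S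
  obtain ⟨u, hu, s, hs, hsad⟩ := Sion.exists_isSaddlePointOn (X := K) (Y := convexHull ℝ S)
    (f := fun u s => inner ℝ s (u - w)) ⟨w, hw⟩ hKc hK
    (fun s _ => by
      have : Continuous fun u : V => inner ℝ s (u - w) := by fun_prop
      exact this.lowerSemicontinuous.lowerSemicontinuousOn _)
    (fun s _ => by
      refine ConvexOn.quasiconvexOn ⟨hKc, fun x _ y _ a b _ _ hab => le_of_eq ?_⟩
      have e : a • x + b • y - w = a • (x - w) + b • (y - w) := by
        obtain rfl : b = 1 - a := by linarith
        module
      simp only [e, inner_add_right, inner_smul_right, smul_eq_mul])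
    hcvx ⟨s₀, subset_convexHull ℝ S hs₀⟩ hS.convexHull_of_finiteDimensional
    (fun u _ => by
      have : Continuous fun s : V => inner ℝ s (u - w) := by fun_prop
      exact this.upperSemicontinuous.upperSemicontinuousOn _)
    (fun u _ => by
      refine ConcaveOn.quasiconcaveOn ⟨hcvx, fun x _ y _ a b _ _ _ => le_of_eq ?_⟩
      simp only [inner_add_left, real_inner_smul_left, smul_eq_mul])
  obtain ⟨s₁, hs₁, hs₁u⟩ := h u hu
  refine ⟨s, hs, -s, fun z hz => ?_, add_neg_cancel s⟩
  have h2 := hsad z hz s₁ (subset_convexHull ℝ S hs₁)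
  simp only at h2
  rw [inner_neg_left]
  linarith

/-- A point `w` of `K` is critical if the function has no descent direction at `w` to first order
within `K`, provided that it is continuous with bounded Fréchet subgradients near `w`. -/
theorem mem_crit_of_slope [FiniteDimensional ℝ V] {D K : Set V} (hD : Convex ℝ D)
    (hDc : IsClosed D) (hK : IsCompact K) (hKc : Convex ℝ K) (hKD : K ⊆ D) {F : V → ℝ} {w : V}
    (hw : w ∈ K) {δ R : ℝ} (hδ : 0 < δ) (hF : ContinuousOn F (D ∩ Metric.closedBall w δ))
    (hsub : ∀ x ∈ D ∩ Metric.closedBall w δ, ∃ s, ‖s‖ ≤ R ∧ IsFrechetSubgradient D F s x)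
    (hslope : ∀ u ∈ K, ∀ r < (0 : ℝ), ∀ᶠ t : ℝ in 𝓝[>] 0, t * r < F (w + t • (u - w)) - F w) :
    w ∈ crit D F K := by
  -- `S` consists of limits of bounded gradients at points tending to `w`
  let A : ℕ → Set V := fun k => {s | ‖s‖ ≤ R ∧ ∃ x ∈ D, ‖x - w‖ < 1 / ((k : ℝ) + 1) ∧
    HasGradientWithinAt F s D x}
  let S : Set V := ⋂ k, closure (A k)
  have hAanti : ∀ k l : ℕ, k ≤ l → A l ⊆ A k := by
    rintro k l hkl s ⟨hs, x, hx, hxw, hg⟩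
    refine ⟨hs, x, hx, hxw.trans_le ?_, hg⟩
    have : (k : ℝ) ≤ l := by exact_mod_cast hkl
    gcongr
  have hAball : ∀ k, closure (A k) ⊆ Metric.closedBall 0 R := fun k =>
    closure_minimal (fun s hs => by simpa using hs.1) Metric.isClosed_closedBall
  have hS : IsCompact S :=
    (isCompact_closedBall (0 : V) R).of_isClosed_subset (isClosed_iInter fun k => isClosed_closure)
      ((Set.iInter_subset _ 0).trans (hAball 0))
  have hSlim : S ⊆ {v | ∃ u s : ℕ → V, (∀ k, u k ∈ D ∧ HasGradientWithinAt F (s k) D (u k)) ∧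
      Tendsto s atTop (𝓝 v) ∧ Tendsto u atTop (𝓝 w)} := by
    intro v hv
    have h1 : ∀ k : ℕ, ∃ s, s ∈ A k ∧ dist v s < 1 / ((k : ℝ) + 1) := fun k => by
      obtain ⟨s, hs, hd⟩ := Metric.mem_closure_iff.1 (Set.mem_iInter.1 hv k) (1 / ((k : ℝ) + 1))
        (by positivity)
      exact ⟨s, hs, hd⟩
    choose s hsA hsd using h1
    choose _ x hxD hxw hg using hsA
    refine ⟨x, s, fun k => ⟨hxD k, hg k⟩, ?_, ?_⟩
    · rw [tendsto_iff_dist_tendsto_zero]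
      refine squeeze_zero (fun k => dist_nonneg) (fun k => ?_) tendsto_one_div_add_atTop_nhds_zero_nat
      rw [dist_comm]
      exact (hsd k).le
    · rw [tendsto_iff_norm_sub_tendsto_zero]
      exact squeeze_zero (fun k => norm_nonneg _) (fun k => (hxw k).le)
        tendsto_one_div_add_atTop_nhds_zero_nat
  have hSdir : ∀ u ∈ K, ∃ s ∈ S, 0 ≤ inner ℝ s (u - w) := by
    intro u hu
    have h1 : ∀ k : ℕ, ∃ s, s ∈ A k ∧ -(1 / ((k : ℝ) + 1)) ≤ inner ℝ s (u - w) := by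
      intro k
      have hk : 0 < 1 / ((k : ℝ) + 1) := by positivity
      have hsubset : D ∩ Metric.closedBall w (min δ (1 / ((k : ℝ) + 1))) ⊆
          D ∩ Metric.closedBall w δ :=
        Set.inter_subset_inter_right _ (Metric.closedBall_subset_closedBall (min_le_left _ _))
      obtain ⟨x, hx, hxw, s, hs, hg, hin⟩ := exists_gradient_of_slope hD hDc (hKD hw) (hKD hu)
        (lt_min hδ hk) (hF.mono hsubset) (fun x hx => hsub x (hsubset hx))
        (hslope u hu _ (neg_lt_zero.2 hk))
      exact ⟨s, ⟨hs, x, hx, hxw.trans_le (min_le_right _ _), hg⟩, hin⟩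
    choose s hsA hsin using h1
    obtain ⟨s', -, φ, hφ, hlim⟩ := (isCompact_closedBall (0 : V) R).tendsto_subseq
      (x := s) fun k => hAball k (subset_closure (hsA k))
    refine ⟨s', Set.mem_iInter.2 fun k => ?_, ?_⟩
    · refine mem_closure_of_tendsto hlim ?_
      filter_upwards [eventually_ge_atTop k] with j hj
      exact hAanti k (φ j) (hj.trans (hφ.id_le j)) (hsA (φ j))
    · have h2 : Tendsto (fun k : ℕ => -(1 / ((φ k : ℝ) + 1))) atTop (𝓝 (-0)) :=
        (tendsto_one_div_add_atTop_nhds_zero_nat.comp hφ.tendsto_atTop).neg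
      rw [neg_zero] at h2
      refine le_of_tendsto_of_tendsto' h2 (hlim.inner tendsto_const_nhds) fun k => hsin (φ k)
  exact ⟨hw, Set.add_subset_add_right (convexHull_mono hSlim)
    (zero_mem_convexHull_add_normalCone hS hK hKc hw hSdir)⟩

/-- If near a critical point `w` every gradient of `F` has slope at most `m` towards `u`, then
`m` is nonnegative. -/
theorem nonneg_of_mem_crit [CompleteSpace V] {D K : Set V} {F : V → ℝ} {w u : V}
    (hw : w ∈ crit D F K) (hu : u ∈ K) {m : ℝ}
    (hm : ∀ᶠ x in 𝓝[D] w, ∀ s, HasGradientWithinAt F s D x → inner ℝ s (u - x) ≤ m) : 0 ≤ m := by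
  obtain ⟨-, s, hs, v, hv, hsv⟩ := hw
  have hle : clarkeSubdifferential D F w ⊆ {s : V | inner ℝ s (u - w) ≤ m} := by
    refine convexHull_min ?_ ?_
    · rintro s' ⟨x, σ, hx, hσ, hxw⟩
      have hxw' : Tendsto x atTop (𝓝[D] w) :=
        tendsto_nhdsWithin_iff.2 ⟨hxw, Eventually.of_forall fun k => (hx k).1⟩
      refine le_of_tendsto (Filter.Tendsto.inner (𝕜 := ℝ) hσ (tendsto_const_nhds.sub hxw)) ?_
      filter_upwards [hxw'.eventually hm] with k hk
      exact hk (σ k) (hx k).2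
    · intro x hx y hy a b ha hb hab
      simp only [Set.mem_ofPred_eq, inner_add_left, real_inner_smul_left] at *
      calc a * inner ℝ x (u - w) + b * inner ℝ y (u - w) ≤ a * m + b * m := by gcongr
        _ = m := by rw [← add_mul, hab, one_mul]
  have h1 := hle hs
  have h2 := hv u hu
  have h3 : s = -v := eq_neg_of_add_eq_zero_left hsv
  rw [Set.mem_ofPred_eq, h3, inner_neg_left] at h1
  linarith

end ConvexAnalysis

/-! ### Maxima of smooth families -/

theorem ciSup_eq_of_forall_le {ι : Type*} {φ : ι → ℝ} {i : ι} (hi : ∀ j, φ j ≤ φ i) :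
    ⨆ j, φ j = φ i :=
  haveI : Nonempty ι := ⟨i⟩
  le_antisymm (ciSup_le hi) (le_ciSup ⟨φ i, Set.forall_mem_range.2 hi⟩ i)

section MaxFunction

variable {V : Type*} [NormedAddCommGroup V] [InnerProductSpace ℝ V] [CompleteSpace V]
  {Z : Type*} [TopologicalSpace Z]

/-- A family `G · ζ` of continuously differentiable functions with gradients `g · ζ`, jointly
continuous in the parameter `ζ`, such that for all points of `D` in the closed ball of radius `δ`
about `w` the parameters outside the compact set `C` have values below that of `ζ₀ ∈ C` by a margin
(normalised to `1`). -/
structure IsTightFamily (D : Set V) (w : V) (δ : ℝ) (G : V → Z → ℝ) (g : V → Z → V) (C : Set Z)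
    (ζ₀ : Z) : Prop where
  cont : Continuous fun q : V × Z => G q.1 q.2
  hasGradientAt : ∀ x ζ, HasGradientAt (fun x => G x ζ) (g x ζ) x
  cont_gradient : Continuous fun q : V × Z => g q.1 q.2
  isCompact : IsCompact C
  mem : ζ₀ ∈ C
  radius_pos : 0 < δ
  le_of_notMem : ∀ x ∈ D ∩ Metric.closedBall w δ, ∀ ζ ∉ C, G x ζ ≤ G x ζ₀ - 1

/-- The mean value theorem along a ray, with gradients. -/
theorem exists_sub_eq_inner_gradient {φ : V → ℝ} {φ' : V → V}
    (h : ∀ x, HasGradientAt φ (φ' x) x) (x v : V) {t : ℝ} (ht : 0 < t) :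
    ∃ τ ∈ Set.Ioo 0 t, φ (x + t • v) - φ x = t * inner ℝ (φ' (x + τ • v)) v := by
  have hd : ∀ τ : ℝ, HasDerivAt (fun τ : ℝ => φ (x + τ • v)) (inner ℝ (φ' (x + τ • v)) v) τ := by
    intro τ
    have h1 : HasDerivAt (fun τ : ℝ => x + τ • v) v τ := by
      simpa using ((hasDerivAt_id τ).smul_const v).const_add x
    have h2 := (h (x + τ • v)).hasFDerivAt.comp_hasDerivAt τ h1
    rw [InnerProductSpace.toDual_apply_apply] at h2
    exact h2
  obtain ⟨τ, hτ, he⟩ := exists_hasDerivAt_eq_slope (fun τ : ℝ => φ (x + τ • v))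
    (fun τ => inner ℝ (φ' (x + τ • v)) v) ht
    (fun τ _ => (hd τ).continuousAt.continuousWithinAt) fun τ _ => hd τ
  refine ⟨τ, hτ, ?_⟩
  rw [he]
  simp only [zero_smul, add_zero, sub_zero]
  field_simp

namespace IsTightFamily

variable {D : Set V} {w : V} {δ : ℝ} {G : V → Z → ℝ} {g : V → Z → V} {C : Set Z} {ζ₀ : Z}

theorem exists_max (h : IsTightFamily D w δ G g C ζ₀) {x : V}
    (hx : x ∈ D ∩ Metric.closedBall w δ) : ∃ ζ ∈ C, ∀ ζ', G x ζ' ≤ G x ζ := by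
  have hc : Continuous (G x) := h.cont.comp (Continuous.prodMk_right x)
  obtain ⟨ζ, hζ, hmax⟩ := h.isCompact.exists_isMaxOn ⟨ζ₀, h.mem⟩ hc.continuousOn
  refine ⟨ζ, hζ, fun ζ' => ?_⟩
  by_cases hζ' : ζ' ∈ C
  · exact hmax hζ'
  · have h1 : G x ζ₀ ≤ G x ζ := hmax h.mem
    linarith [h.le_of_notMem x hx ζ' hζ']

theorem bddAbove (h : IsTightFamily D w δ G g C ζ₀) {x : V}
    (hx : x ∈ D ∩ Metric.closedBall w δ) : BddAbove (Set.range (G x)) := by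
  obtain ⟨ζ, -, hζ⟩ := h.exists_max hx
  exact ⟨G x ζ, Set.forall_mem_range.2 hζ⟩

theorem le_iSup (h : IsTightFamily D w δ G g C ζ₀) {x : V}
    (hx : x ∈ D ∩ Metric.closedBall w δ) (ζ : Z) : G x ζ ≤ ⨆ ζ, G x ζ :=
  le_ciSup (h.bddAbove hx) ζ

theorem mem_of_max (h : IsTightFamily D w δ G g C ζ₀) {x : V}
    (hx : x ∈ D ∩ Metric.closedBall w δ) {ζ : Z} (hζ : ∀ ζ', G x ζ' ≤ G x ζ) : ζ ∈ C := by
  by_contra hC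
  linarith [h.le_of_notMem x hx ζ hC, hζ ζ₀]

theorem exists_gradient_bound [FiniteDimensional ℝ V] (h : IsTightFamily D w δ G g C ζ₀) :
    ∃ R : ℝ, ∀ x ∈ Metric.closedBall w δ, ∀ ζ ∈ C, ‖g x ζ‖ ≤ R := by
  obtain ⟨R, hR⟩ := ((isCompact_closedBall w δ).prod h.isCompact).exists_bound_of_continuousOn
    h.cont_gradient.continuousOn
  exact ⟨R, fun x hx ζ hζ => hR (x, ζ) (Set.mk_mem_prod hx hζ)⟩

theorem continuousOn_iSup [FiniteDimensional ℝ V] (h : IsTightFamily D w δ G g C ζ₀) :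
    ContinuousOn (fun x => ⨆ ζ, G x ζ) (D ∩ Metric.closedBall w δ) := by
  obtain ⟨R, hR⟩ := h.exists_gradient_bound
  refine LipschitzOnWith.continuousOn (K := R.toNNReal) (LipschitzOnWith.of_le_add_mul' R ?_)
  intro x hx u hu
  obtain ⟨ζ, hζC, hζ⟩ := h.exists_max hx
  rw [ciSup_eq_of_forall_le hζ]
  have h1 := h.le_iSup hu ζ
  obtain ⟨τ, hτ, he⟩ := exists_sub_eq_inner_gradient (fun x => h.hasGradientAt x ζ) u (x - u)
    zero_lt_one
  rw [one_smul, add_sub_cancel, one_mul] at he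
  have h2 : u + τ • (x - u) ∈ Metric.closedBall w δ :=
    (convex_closedBall w δ).add_smul_sub_mem hu.2 hx.2 ⟨hτ.1.le, hτ.2.le⟩
  have h3 := (real_inner_le_norm (g (u + τ • (x - u)) ζ) (x - u)).trans
    (mul_le_mul_of_nonneg_right (hR _ h2 ζ hζC) (norm_nonneg _))
  rw [dist_eq_norm]
  linarith

/-- The gradient of an active function is a Fréchet subgradient of the maximum. -/
theorem isFrechetSubgradient_iSup (h : IsTightFamily D w δ G g C ζ₀) {x : V}
    (hx : x ∈ Metric.ball w δ) {ζ : Z} (hζ : ∀ ζ', G x ζ' ≤ G x ζ) :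
    IsFrechetSubgradient D (fun x => ⨆ ζ, G x ζ) (g x ζ) x := by
  intro ε hε
  have h0 : HasGradientWithinAt (fun x => G x ζ) (g x ζ) D x :=
    (h.hasGradientAt x ζ).hasFDerivAt.hasFDerivWithinAt
  have h1 := h0.isFrechetSubgradient ε hε
  have h2 : ∀ᶠ u in 𝓝[D] x, u ∈ Metric.ball w δ :=
    mem_nhdsWithin_of_mem_nhds (Metric.isOpen_ball.mem_nhds hx)
  filter_upwards [h1, h2, self_mem_nhdsWithin] with u hu1 hu2 huD
  rw [ciSup_eq_of_forall_le hζ]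
  exact hu1.trans (h.le_iSup ⟨huD, Metric.ball_subset_closedBall hu2⟩ ζ)

/-- Among the maximisers at `w` there is one whose gradient has the largest slope along `v`. -/
theorem exists_max_max_slope (h : IsTightFamily D w δ G g C ζ₀) (hw : w ∈ D) (v : V) :
    ∃ ζ, (∀ ζ', G w ζ' ≤ G w ζ) ∧
      ∀ ζ', (∀ ζ'', G w ζ'' ≤ G w ζ') → inner ℝ (g w ζ') v ≤ inner ℝ (g w ζ) v := by
  have hwX : w ∈ D ∩ Metric.closedBall w δ :=
    ⟨hw, Metric.mem_closedBall_self h.radius_pos.le⟩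
  obtain ⟨ζ₁, hζ₁, hmax₁⟩ := h.exists_max hwX
  have hc : Continuous (G w) := h.cont.comp (Continuous.prodMk_right w)
  have hgc : Continuous (g w) := h.cont_gradient.comp (Continuous.prodMk_right w)
  have hA : IsCompact (C ∩ {ζ | G w ζ₁ ≤ G w ζ}) :=
    h.isCompact.inter_right (isClosed_le continuous_const hc)
  obtain ⟨ζ, hζ, hζmax⟩ := hA.exists_isMaxOn (f := fun ζ => inner ℝ (g w ζ) v)
    ⟨ζ₁, hζ₁, le_refl (G w ζ₁)⟩ (hgc.inner continuous_const).continuousOn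
  refine ⟨ζ, fun ζ' => (hmax₁ ζ').trans hζ.2, fun ζ' hζ' => hζmax ?_⟩
  exact ⟨h.mem_of_max hwX hζ', hζ' ζ₁⟩

/-- Near `w`, a parameter is either far from maximal or has nearly the slopes of a maximiser. -/
theorem exists_far_or_slope_lt (h : IsTightFamily D w δ G g C ζ₀) {u : V} {m m' : ℝ} (hm : m < m') {ζ₁ : Z} (hmax : ∀ ζ, G w ζ ≤ G w ζ₁)
    (hslope : ∀ ζ, (∀ ζ', G w ζ' ≤ G w ζ) → inner ℝ (g w ζ) (u - w) ≤ m) :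
    ∃ η : ℝ, 0 < η ∧ ∃ r : ℝ, 0 < r ∧ r ≤ δ ∧ ∀ x ∈ D, ∀ x₁ x₂ : V, x ∈ Metric.ball w r →
      x₁ ∈ Metric.ball w r → x₂ ∈ Metric.ball w r → ∀ ζ,
      G x ζ ≤ G w ζ₁ - 3 * η ∨ (ζ ∈ C ∧ inner ℝ (g x₁ ζ) (u - x₂) < m') := by
  have hloc : ∀ ζ ∈ C, ∀ᶠ q : (ℝ × V × V × V) × Z in 𝓝 ((0, w, w, w), ζ),
      G q.1.2.1 q.2 < G w ζ₁ - 3 * q.1.1 ∨ inner ℝ (g q.1.2.2.1 q.2) (u - q.1.2.2.2) < m' := by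
    intro ζ _
    have c1 : Continuous fun q : (ℝ × V × V × V) × Z => G q.1.2.1 q.2 :=
      h.cont.comp (by fun_prop : Continuous fun q : (ℝ × V × V × V) × Z => (q.1.2.1, q.2))
    have c2 : Continuous fun q : (ℝ × V × V × V) × Z =>
        (inner ℝ (g q.1.2.2.1 q.2) (u - q.1.2.2.2) : ℝ) :=
      (h.cont_gradient.comp
        (by fun_prop : Continuous fun q : (ℝ × V × V × V) × Z => (q.1.2.2.1, q.2))).inner
        (by fun_prop)
    have c3 : Continuous fun q : (ℝ × V × V × V) × Z => G w ζ₁ - 3 * q.1.1 := by fun_prop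
    by_cases hζ : ∀ ζ', G w ζ' ≤ G w ζ
    · refine (c2.continuousAt.eventually_lt continuousAt_const ?_).mono fun q => Or.inr
      exact (hslope ζ hζ).trans_lt hm
    · push Not at hζ
      obtain ⟨ζ', hζ'⟩ := hζ
      refine (c1.continuousAt.eventually_lt c3.continuousAt ?_).mono fun q => Or.inl
      have := hmax ζ'
      simp only
      linarith
  obtain ⟨r₁, hr₁, hball⟩ := Metric.eventually_nhds_iff_ball.1
    (h.isCompact.eventually_forall_of_forall_eventually
      (P := fun (q : ℝ × V × V × V) ζ =>
        G q.2.1 ζ < G w ζ₁ - 3 * q.1 ∨ inner ℝ (g q.2.2.1 ζ) (u - q.2.2.2) < m') hloc)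
  have c0 : Continuous fun x => G x ζ₀ := h.cont.comp (Continuous.prodMk_left ζ₀)
  obtain ⟨r₂, hr₂, hball₂⟩ := Metric.eventually_nhds_iff_ball.1
    (c0.continuousAt.eventually_lt_const (lt_add_of_pos_right (G w ζ₀) (half_pos one_pos)))
  set η := min (r₁ / 2) (1 / 6) with hη
  have hη0 : 0 < η := lt_min (by positivity) (by positivity)
  refine ⟨η, hη0, min r₁ (min r₂ δ), lt_min hr₁ (lt_min hr₂ h.radius_pos),
    (min_le_right _ _).trans (min_le_right _ _), fun x hxD x₁ x₂ hx hx₁ hx₂ ζ => ?_⟩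
  have hb1 := Metric.ball_subset_ball (x := w) (min_le_left r₁ (min r₂ δ))
  have hb2 := Metric.ball_subset_ball (x := w)
    ((min_le_right r₁ (min r₂ δ)).trans (min_le_left _ _))
  have hb3 := Metric.ball_subset_ball (x := w)
    ((min_le_right r₁ (min r₂ δ)).trans (min_le_right _ _))
  by_cases hζ : ζ ∈ C
  · have hmem : (η, x, x₁, x₂) ∈ Metric.ball ((0, w, w, w) : ℝ × V × V × V) r₁ := by
      have hηr : |η| < r₁ := by
        rw [abs_of_pos hη0]
        linarith [min_le_left (r₁ / 2) (1 / 6)]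
      have e1 := hb1 hx
      have e2 := hb1 hx₁
      have e3 := hb1 hx₂
      rw [Metric.mem_ball] at e1 e2 e3 ⊢
      simp only [Prod.dist_eq, max_lt_iff, Real.dist_eq, sub_zero]
      exact ⟨hηr, e1, e2, e3⟩
    rcases hball _ hmem ζ hζ with h1 | h1
    · exact Or.inl h1.le
    · exact Or.inr ⟨hζ, h1⟩
  · left
    have h1 := h.le_of_notMem x ⟨hxD, Metric.ball_subset_closedBall (hb3 hx)⟩ ζ hζ
    have h2 := hball₂ x (hb2 hx)
    have h3 := hmax ζ₀
    have h4 : η ≤ 1 / 6 := min_le_right _ _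
    linarith

end IsTightFamily

end MaxFunction

/-! ### Soft maxima -/

section SoftMax

variable {Z : Type*} [MeasurableSpace Z]

/-- The increment of the soft maximum `β log ∫ exp (X / β)` is at most the mean of the increment
`X - Y` under the Gibbs measure with density proportional to `exp (X / β)`. -/
theorem log_integral_exp_sub_le {P : Measure Z} [NeZero P] {X Y : Z → ℝ} {β T : ℝ} (hβ : 0 < β)
    (hX : Integrable (fun ζ => Real.exp (X ζ / β)) P)
    (hY : Integrable (fun ζ => Real.exp (Y ζ / β)) P)
    (hXY : Integrable (fun ζ => Real.exp (X ζ / β) * (X ζ - Y ζ)) P)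
    (h : ∫ ζ, Real.exp (X ζ / β) * (X ζ - Y ζ) ∂P ≤ T * ∫ ζ, Real.exp (X ζ / β) ∂P) :
    β * Real.log (∫ ζ, Real.exp (X ζ / β) ∂P) - β * Real.log (∫ ζ, Real.exp (Y ζ / β) ∂P) ≤ T := by
  have hZ1 : 0 < ∫ ζ, Real.exp (X ζ / β) ∂P := integral_exp_pos hX
  have hle : Real.exp (-(T / β)) * ∫ ζ, Real.exp (X ζ / β) ∂P ≤ ∫ ζ, Real.exp (Y ζ / β) ∂P := by
    have h1 : ∫ ζ, Real.exp (X ζ / β) ∂P ≤ ∫ ζ, ((1 + T / β) * Real.exp (X ζ / β) -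
        β⁻¹ * (Real.exp (X ζ / β) * (X ζ - Y ζ))) ∂P := by
      rw [integral_sub (hX.const_mul _) (hXY.const_mul _), integral_const_mul, integral_const_mul]
      have := mul_le_mul_of_nonneg_left h (inv_nonneg.2 hβ.le)
      have e : T / β * ∫ ζ, Real.exp (X ζ / β) ∂P = β⁻¹ * (T * ∫ ζ, Real.exp (X ζ / β) ∂P) := by
        ring
      rw [add_mul, one_mul, e]
      linarith
    calc Real.exp (-(T / β)) * ∫ ζ, Real.exp (X ζ / β) ∂P
        ≤ Real.exp (-(T / β)) * ∫ ζ, ((1 + T / β) * Real.exp (X ζ / β) -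
          β⁻¹ * (Real.exp (X ζ / β) * (X ζ - Y ζ))) ∂P := by gcongr
      _ = ∫ ζ, Real.exp (-(T / β)) * ((1 + T / β) * Real.exp (X ζ / β) -
          β⁻¹ * (Real.exp (X ζ / β) * (X ζ - Y ζ))) ∂P := (integral_const_mul _ _).symm
      _ ≤ ∫ ζ, Real.exp (Y ζ / β) ∂P := by
        refine integral_mono (((hX.const_mul _).sub (hXY.const_mul _)).const_mul _) hY fun ζ => ?_
        have e1 : Real.exp (Y ζ / β) = Real.exp (-(T / β)) *
            (Real.exp (X ζ / β) * Real.exp ((Y ζ - X ζ + T) / β)) := by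
          rw [← Real.exp_add, ← Real.exp_add]
          congr 1
          ring
        have e2 : (1 + T / β) * Real.exp (X ζ / β) - β⁻¹ * (Real.exp (X ζ / β) * (X ζ - Y ζ)) =
            Real.exp (X ζ / β) * ((Y ζ - X ζ + T) / β + 1) := by ring
        simp only
        rw [e1, e2]
        gcongr
        exact Real.add_one_le_exp _
  have h2 := Real.log_le_log (mul_pos (Real.exp_pos _) hZ1) hle
  rw [Real.log_mul (Real.exp_pos _).ne' hZ1.ne', Real.log_exp] at h2
  have h3 := mul_le_mul_of_nonneg_left h2 hβ.le
  have e : β * (-(T / β) + Real.log (∫ ζ, Real.exp (X ζ / β) ∂P)) =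
      -T + β * Real.log (∫ ζ, Real.exp (X ζ / β) ∂P) := by field_simp
  linarith

variable {V : Type*} [NormedAddCommGroup V] [InnerProductSpace ℝ V] [CompleteSpace V]
  [TopologicalSpace Z]
  {D : Set V} {w : V} {δ : ℝ} {G : V → Z → ℝ} {g : V → Z → V} {C : Set Z} {ζ₀ : Z}

/-- Near `w` and for small `β`, the slope of the soft maximum towards `u` is at most the largest
slope of a maximiser at `w`, up to `ε`: the Gibbs measure concentrates near the maximisers. -/
theorem IsTightFamily.exists_softMax_slope_le [OpensMeasurableSpace Z]
    (h : IsTightFamily D w δ G g C ζ₀) (hD : Convex ℝ D) (hw : w ∈ D) {u : V} (hu : u ∈ D)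
    {P : Measure Z} [IsProbabilityMeasure P] [P.IsOpenPosMeasure] {Ψ : Z → ℝ}
    (hΨ : Integrable Ψ P) (hgΨ : ∀ x ∈ D ∩ Metric.closedBall w δ, ∀ ζ, ‖g x ζ‖ ≤ Ψ ζ)
    {m : ℝ} (hslope : ∀ ζ, (∀ ζ', G w ζ' ≤ G w ζ) → inner ℝ (g w ζ) (u - w) ≤ m)
    {ε : ℝ} (hε : 0 < ε) :
    ∃ r : ℝ, 0 < r ∧ ∃ β₀ : ℝ, 0 < β₀ ∧ ∀ β : ℝ, 0 < β → β ≤ β₀ → ∀ x ∈ D ∩ Metric.ball w r,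
      ∀ᶠ t : ℝ in 𝓝[>] 0,
        β * Real.log (∫ ζ, Real.exp (G (x + t • (u - x)) ζ / β) ∂P) -
          β * Real.log (∫ ζ, Real.exp (G x ζ / β) ∂P) ≤ t * (m + ε) := by
  have hcont : ∀ x, Continuous (G x) := fun x => h.cont.comp (Continuous.prodMk_right x)
  obtain ⟨ζ₁, -, hmax⟩ := h.exists_max ⟨hw, Metric.mem_closedBall_self h.radius_pos.le⟩
  obtain ⟨η, hη, r₁, hr₁, hr₁δ, hfar⟩ := h.exists_far_or_slope_lt
    (lt_add_of_pos_right m (half_pos hε)) hmax hslope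
  -- a neighbourhood of a maximiser bounds the partition function from below
  have hopen : ∀ᶠ q : V × Z in 𝓝 (w, ζ₁), G w ζ₁ - 2 * η < G q.1 q.2 :=
    h.cont.continuousAt.eventually_const_lt (by simp only; linarith)
  rw [nhds_prod_eq, eventually_prod_iff] at hopen
  obtain ⟨p₁, hp₁, p₂, hp₂, hp⟩ := hopen
  obtain ⟨r₂, hr₂, hball₂⟩ := Metric.eventually_nhds_iff_ball.1 hp₁
  obtain ⟨U, hUp, hUo, hUζ⟩ := eventually_nhds_iff.1 hp₂
  set p₀ := P.real U with hp₀
  have hp₀pos : 0 < p₀ :=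
    ENNReal.toReal_pos (hUo.measure_pos P ⟨ζ₁, hUζ⟩).ne' (measure_ne_top P U)
  set r := min r₁ r₂ with hr
  have hr0 : 0 < r := lt_min hr₁ hr₂
  set B := ‖u - w‖ + r with hB
  have hB0 : 0 ≤ B := by positivity
  have hΨ0 : ∀ ζ, 0 ≤ Ψ ζ := fun ζ => (norm_nonneg (g w ζ)).trans
    (hgΨ w ⟨hw, Metric.mem_closedBall_self h.radius_pos.le⟩ ζ)
  have hAint : Integrable (fun ζ => B * Ψ ζ + (|m| + ε)) P :=
    (hΨ.const_mul B).add (integrable_const _)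
  set A := ∫ ζ, (B * Ψ ζ + (|m| + ε)) ∂P with hA
  have hA0 : 0 ≤ A := integral_nonneg fun ζ => by
    have := hΨ0 ζ
    simp only [Pi.zero_apply]
    positivity
  refine ⟨r, hr0, η * (ε / 2 * p₀) / (A + 1), by positivity, fun β hβ hββ₀ x hx => ?_⟩
  have hseg := hD.tendsto_segment hx.1 hu
  have hballr : ∀ᶠ t : ℝ in 𝓝[>] 0, x + t • (u - x) ∈ Metric.ball w r :=
    hseg.eventually (mem_nhdsWithin_of_mem_nhds (Metric.isOpen_ball.mem_nhds hx.2))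
  filter_upwards [hballr, hseg.eventually self_mem_nhdsWithin, self_mem_nhdsWithin]
    with t htr htD ht
  have ht0 : (0 : ℝ) < t := ht
  set x' := x + t • (u - x) with hx'
  have hball_sub : ∀ y ∈ Metric.ball w r, y ∈ Metric.ball w r₁ := fun y hy =>
    Metric.ball_subset_ball (min_le_left _ _) hy
  have hball_cl : ∀ y ∈ Metric.ball w r, y ∈ Metric.closedBall w δ := fun y hy =>
    Metric.ball_subset_closedBall (Metric.ball_subset_ball hr₁δ (hball_sub y hy))
  have hmvt : ∀ ζ, ∃ y ∈ D ∩ Metric.ball w r, G x' ζ - G x ζ = t * inner ℝ (g y ζ) (u - x) := by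
    intro ζ
    obtain ⟨τ, hτ, he⟩ := exists_sub_eq_inner_gradient (fun x => h.hasGradientAt x ζ) x (u - x) ht0
    refine ⟨_, ?_, he⟩
    have h1 : x + τ • (u - x) = x + (τ / t) • (x' - x) := by
      rw [hx', add_sub_cancel_left, smul_smul, div_mul_cancel₀ _ ht0.ne']
    rw [h1]
    exact (hD.inter (convex_ball w r)).add_smul_sub_mem hx ⟨htD, htr⟩
      ⟨div_nonneg hτ.1.le ht0.le, (div_le_one ht0).2 hτ.2.le⟩
  have hux : ‖u - x‖ ≤ B := by
    have h1 : u - x = (u - w) - (x - w) := by abel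
    rw [h1]
    refine (norm_sub_le _ _).trans ?_
    have := hx.2
    rw [Metric.mem_ball, dist_eq_norm] at this
    linarith
  have habs : ∀ ζ, |G x' ζ - G x ζ| ≤ t * (B * Ψ ζ) := by
    intro ζ
    obtain ⟨y, hy, he⟩ := hmvt ζ
    rw [he, abs_mul, abs_of_pos ht0]
    gcongr
    calc |inner ℝ (g y ζ) (u - x)| ≤ ‖g y ζ‖ * ‖u - x‖ := abs_real_inner_le_norm _ _
      _ ≤ Ψ ζ * B := by
        gcongr
        · exact hΨ0 ζ
        · exact hgΨ y ⟨hy.1, hball_cl y hy.2⟩ ζ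
      _ = B * Ψ ζ := mul_comm _ _
  have hmeas : ∀ y, AEStronglyMeasurable (fun ζ => Real.exp (G y ζ / β)) P := fun y =>
    (Real.measurable_exp.comp ((hcont y).measurable.div_const β)).aestronglyMeasurable
  have hbdd : ∀ y ∈ D ∩ Metric.ball w r, ∃ M : ℝ, ∀ ζ, Real.exp (G y ζ / β) ≤ M := by
    intro y hy
    obtain ⟨ζ₂, -, h2⟩ := h.exists_max ⟨hy.1, hball_cl y hy.2⟩
    exact ⟨Real.exp (G y ζ₂ / β), fun ζ => by gcongr; exact h2 ζ⟩
  have hint : ∀ y ∈ D ∩ Metric.ball w r, Integrable (fun ζ => Real.exp (G y ζ / β)) P := by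
    intro y hy
    obtain ⟨M, hM⟩ := hbdd y hy
    refine Integrable.of_bound (hmeas y) M (Eventually.of_forall fun ζ => ?_)
    rw [Real.norm_eq_abs, abs_of_pos (Real.exp_pos _)]
    exact hM ζ
  have hx'D : x' ∈ D ∩ Metric.ball w r := ⟨htD, htr⟩
  have hintprod : Integrable (fun ζ => Real.exp (G x' ζ / β) * (G x' ζ - G x ζ)) P := by
    obtain ⟨M, hM⟩ := hbdd x' hx'D
    refine Integrable.mono' ((hΨ.const_mul B).const_mul t |>.const_mul M)
      ((hmeas x').mul ((hcont x').sub (hcont x)).measurable.aestronglyMeasurable)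
      (Eventually.of_forall fun ζ => ?_)
    rw [norm_mul, Real.norm_eq_abs, Real.norm_eq_abs, abs_of_pos (Real.exp_pos _)]
    exact mul_le_mul (hM ζ) (habs ζ) (abs_nonneg _) ((Real.exp_pos _).le.trans (hM ζ))
  refine log_integral_exp_sub_le hβ (hint x' hx'D) (hint x hx) hintprod ?_
  have hZ : Real.exp ((G w ζ₁ - 2 * η) / β) * p₀ ≤ ∫ ζ, Real.exp (G x' ζ / β) ∂P := by
    have h1 : ∫ ζ in U, Real.exp ((G w ζ₁ - 2 * η) / β) ∂P ≤ ∫ ζ in U, Real.exp (G x' ζ / β) ∂P := by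
      refine setIntegral_mono_on (integrable_const _).integrableOn (hint x' hx'D).integrableOn
        hUo.measurableSet fun ζ hζ => ?_
      gcongr
      exact (hp (hball₂ x' (Metric.ball_subset_ball (min_le_right _ _) htr)) (hUp ζ hζ)).le
    rw [setIntegral_const, smul_eq_mul, mul_comm] at h1
    exact h1.trans (setIntegral_le_integral (hint x' hx'D)
      (Eventually.of_forall fun ζ => (Real.exp_pos _).le))
  -- either `ζ` is far from maximal and the exponential is small, or the increment is bounded
  have hpt : ∀ ζ, Real.exp (G x' ζ / β) * (G x' ζ - G x ζ) ≤
      t * (m + ε / 2) * Real.exp (G x' ζ / β) +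
        Real.exp ((G w ζ₁ - 3 * η) / β) * (t * (B * Ψ ζ + (|m| + ε))) := by
    intro ζ
    have hnn : 0 ≤ t * (B * Ψ ζ + (|m| + ε)) := by
      have := hΨ0 ζ
      positivity
    obtain ⟨y, hy, he⟩ := hmvt ζ
    have hE := Real.exp_pos (G x' ζ / β)
    rcases hfar x' htD y x (hball_sub x' htr) (hball_sub y hy.2) (hball_sub x hx.2) ζ with h1 | h1
    · have h2 : Real.exp (G x' ζ / β) ≤ Real.exp ((G w ζ₁ - 3 * η) / β) := by gcongr
      have h3 : G x' ζ - G x ζ - t * (m + ε / 2) ≤ t * (B * Ψ ζ + (|m| + ε)) := by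
        have h4 := (le_abs_self _).trans (habs ζ)
        have h5 : -(m + ε / 2) ≤ |m| + ε := by linarith [neg_abs_le m]
        have h6 := mul_le_mul_of_nonneg_left h5 ht0.le
        linarith
      have h7 := mul_le_mul_of_nonneg_left h3 hE.le
      have h8 := mul_le_mul_of_nonneg_right h2 hnn
      linarith
    · have h2 : G x' ζ - G x ζ ≤ t * (m + ε / 2) := by
        rw [he]
        exact mul_le_mul_of_nonneg_left h1.2.le ht0.le
      have h3 := mul_le_mul_of_nonneg_left h2 hE.le
      have h4 := mul_nonneg (Real.exp_pos ((G w ζ₁ - 3 * η) / β)).le hnn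
      linarith
  have hsum := integral_mono hintprod (((hint x' hx'D).const_mul (t * (m + ε / 2))).add
    ((hAint.const_mul t).const_mul (Real.exp ((G w ζ₁ - 3 * η) / β)))) hpt
  simp only [Pi.add_apply] at hsum
  rw [integral_add ((hint x' hx'D).const_mul _) ((hAint.const_mul t).const_mul _),
    integral_const_mul, integral_const_mul, integral_const_mul, ← hA] at hsum
  have hsmall : Real.exp ((G w ζ₁ - 3 * η) / β) * A ≤
      ε / 2 * (Real.exp ((G w ζ₁ - 2 * η) / β) * p₀) := by
    have e : Real.exp ((G w ζ₁ - 2 * η) / β) =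
        Real.exp ((G w ζ₁ - 3 * η) / β) * Real.exp (η / β) := by
      rw [← Real.exp_add]
      congr 1
      ring
    have h1 : A ≤ ε / 2 * p₀ * Real.exp (η / β) := by
      have h2 : β * (A + 1) ≤ η * (ε / 2 * p₀) := by
        rwa [le_div_iff₀ (by positivity)] at hββ₀
      have h3 : A + 1 ≤ ε / 2 * p₀ * (η / β) := by
        rw [← mul_div_assoc, le_div_iff₀ hβ]
        linarith
      have h4 : η / β ≤ Real.exp (η / β) := (by linarith [Real.add_one_le_exp (η / β)])
      have h5 : ε / 2 * p₀ * (η / β) ≤ ε / 2 * p₀ * Real.exp (η / β) := by gcongr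
      linarith
    rw [e]
    have := mul_le_mul_of_nonneg_left h1 (Real.exp_pos ((G w ζ₁ - 3 * η) / β)).le
    linarith
  have h9 := mul_le_mul_of_nonneg_left (hsmall.trans
    (mul_le_mul_of_nonneg_left hZ (half_pos hε).le)) ht0.le
  linarith

end SoftMax

/-! ### The dual functions of the robust problem -/

section DualFunctions

variable {p d J n : ℕ}

/-- The gradient in `(θ, l)` of `f θ ζ - l * c ξ ζ`. -/
noncomputable def dualGradient (f : Euc p → SampleSpace d J → ℝ)
    (c : SampleSpace d J → SampleSpace d J → ℝ) (ξ : SampleSpace d J) (w : ParamSpace p)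
    (ζ : SampleSpace d J) : ParamSpace p :=
  WithLp.toLp 2 (gradient (fun θ => f θ ζ) w.fst, -c ξ ζ)

theorem norm_toLp_prod_le (a : Euc p) (b : ℝ) :
    ‖(WithLp.toLp 2 (a, b) : ParamSpace p)‖ ≤ ‖a‖ + |b| := by
  refine le_of_sq_le_sq ?_ (by positivity)
  rw [WithLp.prod_norm_sq_eq_of_L2]
  change ‖a‖ ^ 2 + |b| ^ 2 ≤ _
  nlinarith [mul_nonneg (norm_nonneg a) (abs_nonneg b)]

theorem abs_snd_le_norm (w : ParamSpace p) : |w.snd| ≤ ‖w‖ := by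
  refine le_of_sq_le_sq ?_ (norm_nonneg _)
  rw [WithLp.prod_norm_sq_eq_of_L2, Real.norm_eq_abs]
  nlinarith [norm_nonneg w.fst]

theorem inner_toLp_zero (ρ : ℝ) (w : ParamSpace p) :
    inner ℝ (WithLp.toLp 2 ((0 : Euc p), ρ) : ParamSpace p) w = w.snd * ρ := by
  simp [WithLp.prod_inner_apply]

/-- Continuity on a product with the sample space can be checked for each label separately. -/
theorem continuous_of_discrete_label {X Y : Type*} [TopologicalSpace X] [TopologicalSpace Y]
    {φ : X × SampleSpace d J → Y}
    (h : ∀ y : Fin J, Continuous fun q : X × Euc d => φ (q.1, (q.2, y))) : Continuous φ := by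
  have h1 : Continuous fun q : (X × Euc d) × Fin J => φ (q.1.1, (q.1.2, q.2)) :=
    continuous_prod_of_discrete_right.2 h
  exact h1.comp (by fun_prop :
    Continuous fun q : X × SampleSpace d J => ((q.1, q.2.1), q.2.2))

namespace WDROAssumption

variable {Θ : Set (Euc p)} {f : Euc p → SampleSpace d J → ℝ}
  {c : SampleSpace d J → SampleSpace d J → ℝ}
  {π₀ : SampleSpace d J → Measure (SampleSpace d J)} {lam : SampleSpace d J → ℝ}

theorem continuous_loss (h : WDROAssumption Θ f c π₀ lam) :
    Continuous fun q : Euc p × SampleSpace d J => f q.1 q.2 :=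
  continuous_of_discrete_label fun y => (h.smooth y).continuous

theorem hasFDerivAt_loss (h : WDROAssumption Θ f c π₀ lam) (θ : Euc p) (ζ : SampleSpace d J) :
    HasFDerivAt (fun θ => f θ ζ) ((fderiv ℝ (fun q : Euc p × Euc d => f q.1 (q.2, ζ.2))
      (θ, ζ.1)).comp (ContinuousLinearMap.inl ℝ (Euc p) (Euc d))) θ := by
  have h1 := ((h.smooth ζ.2).differentiable one_ne_zero (θ, ζ.1)).hasFDerivAt
  exact HasFDerivAt.comp (f := fun θ : Euc p => (θ, ζ.1)) θ h1 (hasFDerivAt_prodMk_left θ ζ.1)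

theorem hasGradientAt_loss (h : WDROAssumption Θ f c π₀ lam) (θ : Euc p) (ζ : SampleSpace d J) :
    HasGradientAt (fun θ => f θ ζ) (gradient (fun θ => f θ ζ) θ) θ :=
  (h.hasFDerivAt_loss θ ζ).differentiableAt.hasGradientAt

theorem continuous_gradient_loss (h : WDROAssumption Θ f c π₀ lam) :
    Continuous fun q : Euc p × SampleSpace d J => gradient (fun θ => f θ q.2) q.1 := by
  refine continuous_of_discrete_label fun y => ?_
  have h1 : Continuous fun q : Euc p × Euc d =>
      (fderiv ℝ (fun q : Euc p × Euc d => f q.1 (q.2, y)) q).comp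
        (ContinuousLinearMap.inl ℝ (Euc p) (Euc d)) :=
    ((h.smooth y).continuous_fderiv one_ne_zero).clm_comp continuous_const
  refine ((InnerProductSpace.toDual ℝ (Euc p)).symm.continuous.comp h1).congr fun q => ?_
  rw [Function.comp_apply, gradient, (h.hasFDerivAt_loss q.1 (q.2, y)).fderiv]

theorem hasGradientAt_dual (h : WDROAssumption Θ f c π₀ lam) (ξ ζ : SampleSpace d J)
    (w : ParamSpace p) :
    HasGradientAt (fun w : ParamSpace p => f w.fst ζ - w.snd * c ξ ζ) (dualGradient f c ξ w ζ) w := by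
  rw [hasGradientAt_iff_hasFDerivAt]
  have h1 : HasFDerivAt (fun w : ParamSpace p => f w.fst ζ) _ w :=
    (h.hasGradientAt_loss w.fst ζ).hasFDerivAt.comp w
      (WithLp.fstL 2 ℝ (Euc p) ℝ).hasFDerivAt
  have h2 : HasFDerivAt (fun w : ParamSpace p => w.snd * c ξ ζ) _ w :=
    (WithLp.sndL 2 ℝ (Euc p) ℝ).hasFDerivAt.mul_const (c ξ ζ)
  refine (h1.sub h2).congr_fderiv ?_
  ext v
  simp [dualGradient, WithLp.prod_inner_apply]
  ring

/-- At `w = (θ, l)` with `l ≥ lam ξ` and `l > 0`, the growth condition leaves a margin of at least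
`l / 4` times the cost on the ball of radius `l / 4`, so the supremum is attained where the cost is
bounded. -/
theorem isTightFamily (h : WDROAssumption Θ f c π₀ lam) (ξ : SampleSpace d J) {w : ParamSpace p}
    (hw : lam ξ ≤ w.snd) (hw0 : 0 < w.snd) :
    ∃ C, IsTightFamily (paramProd Θ (Set.Ici 0)) w (w.snd / 4)
      (fun w ζ => f w.fst ζ - w.snd * c ξ ζ) (dualGradient f c ξ) C ξ := by
  obtain ⟨μ, hμ⟩ := h.growth ξ
  have hc2 : Continuous (c ξ) := (h.cost_coercive ξ).1
  have hfξ : Continuous fun x : ParamSpace p => f x.fst ξ :=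
    h.continuous_loss.comp (by fun_prop : Continuous fun x : ParamSpace p => (x.fst, ξ))
  obtain ⟨M, hM⟩ := (isCompact_closedBall w (w.snd / 4)).exists_bound_of_continuousOn
    hfξ.continuousOn
  refine ⟨{ζ | c ξ ζ ≤ max 0 ((μ + M + 1) / (w.snd / 4))}, ?_, fun x ζ => h.hasGradientAt_dual ξ ζ x, ?_,
    (h.cost_coercive ξ).2 _, ?_, by positivity, ?_⟩
  · have h1 := h.continuous_loss.comp (by fun_prop :
      Continuous fun q : ParamSpace p × SampleSpace d J => (q.1.fst, q.2))
    have h2 : Continuous fun q : ParamSpace p × SampleSpace d J => q.1.snd * c ξ q.2 := by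
      fun_prop
    exact h1.sub h2
  · have h1 := h.continuous_gradient_loss.comp (by fun_prop :
      Continuous fun q : ParamSpace p × SampleSpace d J => (q.1.fst, q.2))
    have h2 : Continuous fun q : ParamSpace p × SampleSpace d J => -c ξ q.2 := by fun_prop
    exact (WithLp.prod_continuous_toLp 2 (Euc p) ℝ).comp (h1.prodMk h2)
  · simp [h.cost_self ξ]
  · rintro x ⟨hxD, hx⟩ ζ hζ
    have hζ' : max 0 ((μ + M + 1) / (w.snd / 4)) < c ξ ζ := not_le.1 hζ
    have hx1 : |x.snd - w.snd| ≤ w.snd / 4 := by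
      have h1 := abs_snd_le_norm (x - w)
      rw [Metric.mem_closedBall, dist_eq_norm] at hx
      exact h1.trans hx
    have hx2 := (abs_le.1 hx1).1
    have h1 := hμ x.fst hxD.1 ζ
    have h2 := (abs_le.1 (hM x hx)).1
    have h3 : μ + M + 1 < c ξ ζ * (w.snd / 4) := by
      rw [← div_lt_iff₀ (by positivity)]
      exact (le_max_right _ _).trans_lt hζ'
    have h4 := h.cost_nonneg ξ ζ
    simp only [h.cost_self ξ, mul_zero, sub_zero]
    have h5 : (w.snd / 4 + lam ξ / 2) * c ξ ζ ≤ x.snd * c ξ ζ := by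
      gcongr
      linarith
    linarith

theorem _root_.MeasureTheory.integrable_of_integrable_rpow_one_add {Z : Type*} [MeasurableSpace Z] {P : Measure Z} [IsFiniteMeasure P]
    {φ : Z → ℝ} (hφ : Measurable φ) (hφ0 : ∀ z, 0 ≤ φ z) {a : ℝ} (ha : 0 < a)
    (h : Integrable (fun z => φ z ^ (1 + a)) P) : Integrable φ P := by
  refine Integrable.mono' ((integrable_const (1 : ℝ)).add h) hφ.aestronglyMeasurable
    (Eventually.of_forall fun z => ?_)
  rw [Real.norm_eq_abs, abs_of_nonneg (hφ0 z), Pi.add_apply]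
  rcases le_total (φ z) 1 with h1 | h1
  · linarith [Real.rpow_nonneg (hφ0 z) (1 + a)]
  · linarith [Real.self_le_rpow_of_one_le h1 (by linarith : 1 ≤ 1 + a)]

/-- The gradients of the dual integrands are dominated by an integrable function. -/
theorem exists_integrable_bound (h : WDROAssumption Θ f c π₀ lam)
    (hπ₀ : ∀ ξ, IsProbabilityMeasure (π₀ ξ)) (hΘ : Θ.Nonempty) (ξ : SampleSpace d J) :
    ∃ Ψ : SampleSpace d J → ℝ, Integrable Ψ (π₀ ξ) ∧
      ∀ w : ParamSpace p, w.fst ∈ Θ → ∀ ζ, ‖dualGradient f c ξ w ζ‖ ≤ Ψ ζ := by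
  obtain ⟨a, ha, ψ, hψ, hc, hψb, hψi⟩ := h.moments
  obtain ⟨θ, hθ⟩ := hΘ
  have := hπ₀ ξ
  refine ⟨fun ζ => ψ ζ + c ξ ζ, ?_, fun w hw ζ => ?_⟩
  · exact (integrable_of_integrable_rpow_one_add hψ.1.measurable
      (fun ζ => (norm_nonneg _).trans (hψb ζ θ hθ).le) ha (hψi ξ)).add
      (integrable_of_integrable_rpow_one_add (h.cost_coercive ξ).1.measurable (h.cost_nonneg ξ) ha (hc ξ))
  · refine (norm_toLp_prod_le _ _).trans ?_
    rw [abs_neg, abs_of_nonneg (h.cost_nonneg ξ ζ)]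
    linarith [hψb ζ w.fst hw]

/-- Open sets of samples contain open slices, which are not Lebesgue-null. -/
theorem isOpenPosMeasure (h : WDROAssumption Θ f c π₀ lam) (ξ : SampleSpace d J) :
    (π₀ ξ).IsOpenPosMeasure := by
  refine ⟨fun U hU ⟨ζ, hζ⟩ h0 => ?_⟩
  set A : Set (Euc d) := {x | (x, ζ.2) ∈ U} with hA
  have hAo : IsOpen A := hU.preimage (by fun_prop : Continuous fun x : Euc d => (x, ζ.2))
  have h1 : ((π₀ ξ).restrict (Set.univ ×ˢ {ζ.2})).map Prod.fst A = 0 := by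
    rw [Measure.map_apply measurable_fst hAo.measurableSet,
      Measure.restrict_apply (measurable_fst hAo.measurableSet)]
    refine measure_mono_null ?_ h0
    rintro ⟨x, y⟩ ⟨hx, -, hy⟩
    have hy' : y = ζ.2 := hy
    subst hy'
    exact hx
  exact hAo.measure_ne_zero volume ⟨ζ.1, hζ⟩ (h.lebesgue_ac ξ ζ.2 h1)

end WDROAssumption

/-! ### Limits of critical points -/

theorem convex_paramProd {Θ : Set (Euc p)} (hΘ : Convex ℝ Θ) {L : Set ℝ} (hL : Convex ℝ L) :
    Convex ℝ (paramProd Θ L) := fun _ hx _ hy _ _ ha hb hab =>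
  ⟨hΘ hx.1 hy.1 ha hb hab, hL hx.2 hy.2 ha hb hab⟩

theorem isClosed_paramProd {Θ : Set (Euc p)} (hΘ : IsClosed Θ) {L : Set ℝ} (hL : IsClosed L) :
    IsClosed (paramProd Θ L) :=
  (hΘ.preimage (by fun_prop : Continuous fun w : ParamSpace p => w.fst)).inter
    (hL.preimage (by fun_prop : Continuous fun w : ParamSpace p => w.snd))

theorem isCompact_paramProd {Θ : Set (Euc p)} (hΘ : IsCompact Θ) {L : Set ℝ} (hL : IsCompact L) :
    IsCompact (paramProd Θ L) := by
  have h1 := (hΘ.prod hL).image (WithLp.prod_continuous_toLp 2 (Euc p) ℝ)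
  refine h1.of_isClosed_subset (isClosed_paramProd hΘ.isClosed hL.isClosed) fun w hw => ?_
  exact ⟨(w.fst, w.snd), hw, rfl⟩

/-- A point that is a limit of critical points of `F^β`, `β → 0`, is a critical point of `F`. -/
theorem mem_crit_objective_of_frequently (hn : 0 < n) {Θ : Set (Euc p)} (hΘc : IsCompact Θ)
    (hΘ : Convex ℝ Θ) {f : Euc p → SampleSpace d J → ℝ}
    {c : SampleSpace d J → SampleSpace d J → ℝ}
    {π₀ : SampleSpace d J → Measure (SampleSpace d J)} (hπ₀ : ∀ ξ, IsProbabilityMeasure (π₀ ξ))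
    {lam : SampleSpace d J → ℝ} (hA : WDROAssumption Θ f c π₀ lam) {ρ : ℝ}
    {ξ : Fin n → SampleSpace d J} {L : Set ℝ} (hL : IsCompact L) (hLc : Convex ℝ L)
    (hLlam : ∀ l ∈ L, ∀ i, lam (ξ i) ≤ l) (hpos : ∀ l ∈ L, 0 < l) {w : ParamSpace p}
    (hw : w ∈ paramProd Θ L)
    (hfreq : ∀ r : ℝ, 0 < r → ∃ β, 0 < β ∧ β ≤ r ∧ ∃ w' ∈ Metric.ball w r,
      w' ∈ crit (paramProd Θ (Set.Ici 0)) (regObjective f c π₀ ρ β ξ) (paramProd Θ L)) :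
    w ∈ crit (paramProd Θ (Set.Ici 0)) (objective f c ρ ξ) (paramProd Θ L) := by
  set D : Set (ParamSpace p) := paramProd Θ (Set.Ici 0) with hDdef
  have hD : Convex ℝ D := convex_paramProd hΘ (convex_Ici 0)
  have hKD : paramProd Θ L ⊆ D := fun x hx => ⟨hx.1, (hpos _ hx.2).le⟩
  have hwD := hKD hw
  have hw0 : 0 < w.snd := hpos _ hw.2
  have hn' : (0 : ℝ) < 1 / (n : ℝ) := by positivity
  choose C hC using fun i => hA.isTightFamily (ξ i) (hLlam _ hw.2 i) hw0
  have hlin : ∀ x : ParamSpace p, IsFrechetSubgradient D (fun x : ParamSpace p => x.snd * ρ)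
      (WithLp.toLp 2 ((0 : Euc p), ρ)) x := by
    intro x ε hε
    filter_upwards with u
    rw [inner_toLp_zero, WithLp.sub_snd]
    have : 0 ≤ ε * ‖u - x‖ := by positivity
    linarith
  -- averages of gradients of active functions are subgradients of the objective
  have hsubgrad : ∀ x ∈ Metric.ball w (w.snd / 4), ∀ ζ : Fin n → SampleSpace d J,
      (∀ i ζ', f x.fst ζ' - x.snd * c (ξ i) ζ' ≤ f x.fst (ζ i) - x.snd * c (ξ i) (ζ i)) →
      IsFrechetSubgradient D (objective f c ρ ξ) (WithLp.toLp 2 ((0 : Euc p), ρ) +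
        (1 / (n : ℝ)) • ∑ i, dualGradient f c (ξ i) x (ζ i)) x := fun x hx ζ hζ =>
    (hlin x).add ((IsFrechetSubgradient.sum Finset.univ fun i _ =>
      (hC i).isFrechetSubgradient_iSup hx (hζ i)).const_mul hn')
  choose R hR using fun i => (hC i).exists_gradient_bound
  have hball : Metric.closedBall w (w.snd / 8) ⊆ Metric.ball w (w.snd / 4) :=
    Metric.closedBall_subset_ball (by linarith)
  refine mem_crit_of_slope hD (isClosed_paramProd hΘc.isClosed isClosed_Ici)
    (isCompact_paramProd hΘc hL) (convex_paramProd hΘ hLc) hKD hw (δ := w.snd / 8)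
    (R := |ρ| + 1 / (n : ℝ) * ∑ i, R i) (by positivity) ?_ ?_ ?_
  · have h1 : ∀ i, ContinuousOn (fun x : ParamSpace p => dualFun f c (ξ i) x.fst x.snd)
        (D ∩ Metric.closedBall w (w.snd / 8)) := fun i =>
      (hC i).continuousOn_iSup.mono (Set.inter_subset_inter_right _
        (Metric.closedBall_subset_closedBall (by linarith)))
    have h2 : Continuous fun x : ParamSpace p => x.snd * ρ := by fun_prop
    exact h2.continuousOn.add (continuousOn_const.mul (continuousOn_finsetSum _ fun i _ => h1 i))
  · rintro x ⟨hxD, hx⟩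
    have hx' := Metric.ball_subset_closedBall (hball hx)
    choose ζ hζC hζ using fun i => (hC i).exists_max ⟨hxD, hx'⟩
    refine ⟨_, ?_, hsubgrad x (hball hx) ζ hζ⟩
    refine (norm_add_le _ _).trans (add_le_add ?_ ?_)
    · simp
    · rw [norm_smul, Real.norm_eq_abs, abs_of_pos hn']
      gcongr
      exact (norm_sum_le _ _).trans (Finset.sum_le_sum fun i _ => hR i x hx' _ (hζC i))
  · intro u hu r hr
    choose ζ hζ hζs using fun i => (hC i).exists_max_max_slope hwD (u - w)
    have hs := hsubgrad w (Metric.mem_ball_self (by positivity)) ζ hζ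
    refine hs.eventually_lt hD hwD (hKD hu) (hr.trans_le ?_)
    set m : Fin n → ℝ := fun i => inner ℝ (dualGradient f c (ξ i) w (ζ i)) (u - w) with hm
    have hinner : inner ℝ (WithLp.toLp 2 ((0 : Euc p), ρ) +
        (1 / (n : ℝ)) • ∑ i, dualGradient f c (ξ i) w (ζ i)) (u - w) =
        (u - w).snd * ρ + 1 / (n : ℝ) * ∑ i, m i := by
      rw [inner_add_left, inner_toLp_zero, real_inner_smul_left, sum_inner]
    rw [hinner]
    refine le_of_forall_pos_le_add fun ε hε => ?_
    choose Ψ hΨ hΨb using fun i => hA.exists_integrable_bound hπ₀ ⟨_, hw.1⟩ (ξ i)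
    have hsoft : ∀ i, ∃ r : ℝ, 0 < r ∧ ∃ β₀ : ℝ, 0 < β₀ ∧ ∀ β : ℝ, 0 < β → β ≤ β₀ →
        ∀ x ∈ D ∩ Metric.ball w r, ∀ᶠ t : ℝ in 𝓝[>] 0,
          smoothDualFun f c π₀ β (ξ i) (x + t • (u - x)).fst (x + t • (u - x)).snd -
            smoothDualFun f c π₀ β (ξ i) x.fst x.snd ≤ t * (m i + ε / 2) := fun i =>
      have := hπ₀ (ξ i)
      have := hA.isOpenPosMeasure (ξ i)
      (hC i).exists_softMax_slope_le hD hwD (hKD hu) (hΨ i) (fun x hx => hΨb i x hx.1.1)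
        (hζs i) (half_pos hε)
    choose r₁ hr₁ β₁ hβ₁ hsoft using hsoft
    obtain ⟨r₂, ⟨hr₂, hr₂β⟩, hr₂ρ⟩ := (((eventually_all.2 fun i => Ioc_mem_nhdsGT (hr₁ i)).and
      (eventually_all.2 fun i => Ioc_mem_nhdsGT (hβ₁ i))).and
      (Ioc_mem_nhdsGT (by positivity : 0 < ε / 2 / (|ρ| + 1)))).exists
    obtain ⟨β, hβ, hβr, w', hw', hcrit⟩ := hfreq r₂ hr₂ρ.1
    refine nonneg_of_mem_crit (m := (u - w).snd * ρ + 1 / (n : ℝ) * ∑ i, m i + ε) hcrit hu ?_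
    filter_upwards [self_mem_nhdsWithin,
      mem_nhdsWithin_of_mem_nhds (Metric.isOpen_ball.mem_nhds hw')] with x hxD hx s hs
    refine hs.isFrechetSubgradient.inner_le hD hxD (hKD hu) ?_
    have hall : ∀ᶠ t : ℝ in 𝓝[>] 0, ∀ i,
        smoothDualFun f c π₀ β (ξ i) (x + t • (u - x)).fst (x + t • (u - x)).snd -
          smoothDualFun f c π₀ β (ξ i) x.fst x.snd ≤ t * (m i + ε / 2) :=
      eventually_all.2 fun i => hsoft i β hβ (hβr.trans (hr₂β i).2) x
        ⟨hxD, Metric.ball_subset_ball (hr₂ i).2 hx⟩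
    filter_upwards [hall, self_mem_nhdsWithin] with t ht ht0
    have ht0' : (0 : ℝ) < t := ht0
    have hsum : ∑ i, smoothDualFun f c π₀ β (ξ i) (x + t • (u - x)).fst (x + t • (u - x)).snd -
        ∑ i, smoothDualFun f c π₀ β (ξ i) x.fst x.snd ≤ t * (∑ i, m i + n * (ε / 2)) := by
      rw [← Finset.sum_sub_distrib]
      refine (Finset.sum_le_sum fun i _ => ht i).trans_eq ?_
      rw [← Finset.mul_sum, Finset.sum_add_distrib]
      simp
    have hsum' := mul_le_mul_of_nonneg_left hsum hn'.le
    have e1 : 1 / (n : ℝ) * (t * (∑ i, m i + n * (ε / 2))) =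
        t * (1 / (n : ℝ) * ∑ i, m i + ε / 2) := by
      have : (n : ℝ) ≠ 0 := by positivity
      field_simp
    have hlinx : (u - x).snd * ρ ≤ (u - w).snd * ρ + ε / 2 := by
      have h1 : (u - x).snd * ρ - (u - w).snd * ρ = (w - x).snd * ρ := by
        simp only [WithLp.sub_snd]; ring
      have h2 : |(w - x).snd| ≤ r₂ := by
        refine (abs_snd_le_norm _).trans ?_
        rw [Metric.mem_ball, dist_comm, dist_eq_norm] at hx
        exact hx.le
      have h3 : (w - x).snd * ρ ≤ r₂ * |ρ| := by
        refine (le_abs_self _).trans ?_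
        rw [abs_mul]
        gcongr
      have h4 : r₂ * (|ρ| + 1) ≤ ε / 2 := by
        rw [← le_div_iff₀ (by positivity)]
        exact hr₂ρ.2
      linarith [hr₂ρ.1]
    have hlint := mul_le_mul_of_nonneg_left hlinx ht0'.le
    have e2 : (x + t • (u - x)).snd * ρ - x.snd * ρ = t * ((u - x).snd * ρ) := by
      simp only [WithLp.add_snd, WithLp.smul_snd, smul_eq_mul]; ring
    unfold regObjective
    linarith

end DualFunctions

theorem mainTheorem1 {p d J n : ℕ} (hn : 0 < n)
    (Θ : Set (Euc p)) (hΘc : IsCompact Θ) (hΘ : Convex ℝ Θ)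
    (f : Euc p → SampleSpace d J → ℝ)
    (c : SampleSpace d J → SampleSpace d J → ℝ)
    (π₀ : SampleSpace d J → Measure (SampleSpace d J))
    (hπ₀ : ∀ ξ, IsProbabilityMeasure (π₀ ξ))
    (lam : SampleSpace d J → ℝ)
    (hA : WDROAssumption Θ f c π₀ lam)
    (ρ : ℝ) (hρ : 0 < ρ)
    (ξ : Fin n → SampleSpace d J)
    (lamMax : ℝ) (hmax : 0 < lamMax)
    (hpos : ∀ l ∈ dualSegment lam lamMax ξ, 0 < l) :
    ∀ ε : ℝ, 0 < ε → ∃ βbar : ℝ, 0 < βbar ∧ ∀ β : ℝ, 0 < β → β ≤ βbar →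
      crit (paramProd Θ (Set.Ici 0)) (regObjective f c π₀ ρ β ξ)
          (paramProd Θ (dualSegment lam lamMax ξ)) ⊆
        crit (paramProd Θ (Set.Ici 0)) (objective f c ρ ξ)
          (paramProd Θ (dualSegment lam lamMax ξ)) + Metric.closedBall 0 ε := by
  intro ε hε
  have hL : IsCompact (dualSegment lam lamMax ξ) :=
    (isCompact_Icc (a := lam (ξ (⟨0, hn⟩ : Fin n))) (b := lamMax)).of_isClosed_subset
      (isClosed_iInter fun i => isClosed_Icc) (Set.iInter_subset _ (⟨0, hn⟩ : Fin n))
  have hLc : Convex ℝ (dualSegment lam lamMax ξ) := convex_iInter fun i => convex_Icc _ _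
  have hLlam : ∀ l ∈ dualSegment lam lamMax ξ, ∀ i, lam (ξ i) ≤ l := fun l hl i =>
    (Set.mem_iInter.1 hl i).1
  by_contra! hcon
  have hseq : ∀ k : ℕ, ∃ β : ℝ, 0 < β ∧ β ≤ 1 / ((k : ℝ) + 1) ∧ ∃ w,
      w ∈ crit (paramProd Θ (Set.Ici 0)) (regObjective f c π₀ ρ β ξ)
        (paramProd Θ (dualSegment lam lamMax ξ)) ∧
      w ∉ crit (paramProd Θ (Set.Ici 0)) (objective f c ρ ξ)
        (paramProd Θ (dualSegment lam lamMax ξ)) + Metric.closedBall 0 ε := by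
    intro k
    obtain ⟨β, hβ, hβk, hnot⟩ := hcon (1 / ((k : ℝ) + 1)) (by positivity)
    obtain ⟨w, hw, hw'⟩ := Set.not_subset.1 hnot
    exact ⟨β, hβ, hβk, w, hw, hw'⟩
  choose β hβ hβk x hx hx' using hseq
  obtain ⟨w, hw, φ, hφ, hlim⟩ := (isCompact_paramProd hΘc hL).tendsto_subseq fun k => (hx k).1
  have hcrit := mem_crit_objective_of_frequently (ρ := ρ) hn hΘc hΘ hπ₀ hA hL hLc hLlam hpos hw
    fun r hr => by
      have h1 : ∀ᶠ k in atTop, 1 / ((φ k : ℝ) + 1) < r :=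
        (tendsto_one_div_add_atTop_nhds_zero_nat.comp hφ.tendsto_atTop).eventually_lt_const hr
      obtain ⟨k, hk1, hk2⟩ := (h1.and (hlim.eventually (Metric.ball_mem_nhds w hr))).exists
      exact ⟨β (φ k), hβ _, (hβk _).trans hk1.le, x (φ k), hk2, hx _⟩
  obtain ⟨k, hk⟩ := (hlim.eventually (Metric.closedBall_mem_nhds w hε)).exists
  refine hx' (φ k) (Set.mem_add.2 ⟨w, hcrit, x (φ k) - w, ?_, add_sub_cancel w _⟩)
  rw [mem_closedBall_zero_iff, ← dist_eq_norm]
  exact hk
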